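/- Let $\mathcal V$ be a ground set of $n\ge 1$ elements with weights $w:\mathcal V\to(0,\infty)$, let $\rho=\max_{v}w(v)/\min_{v}w(v)$, and let $f:2^{\mathcal V}\to[0,\infty)$ be monotone and submodular, i.e. $f(A)\le f(B)$ for $A\subseteq B\subseteq\mathcal V$ and $f(A\cup B)+f(A\cap B)\le f(A)+f(B)$ for all $A,B\subseteq\mathcal V$. The function $f$ can be accessed only through an oracle: one query returns $f(A)$ for one set $A\subseteq\mathcal V$. Starting from $V_0=\emptyset$, elements of $\mathcal V$ are inserted and deleted one at a time (an element may be inserted and deleted repeatedly) by an oblivious adversary, i.e. the sequence of updates, like $w$ and $f$, is fixed independently of the random choices of the algorithm; $V_t$ is the set of elements present after the first $t$ updates. Write $\mathrm{Cost}(S)=\sum_{v\in S}w(v)$ and $\mathrm{OPT}_t=\min\{\mathrm{Cost}(S): S\subseteq V_t,\ f(S)=f(V_t)\}$. There are an absolute constant $C>0$ and a polynomial $P$ in three variables such that for every $\varepsilon>0$ there is a randomized algorithm with the following properties. It is given $n$, the smallest and the largest weight in advance, and each update together with the weight of the updated element only when the update takes place. For all $\mathcal V,w,f$ as above, for every sequence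 of updates and for every $t\ge 0$, the set $S_t$ maintained after the first $t$ updates satisfies 1. $S_t\subseteq V_t$ and $\mathrm{Cost}(S_t)\le \frac{C}{\varepsilon}\,\mathrm{OPT}_t$ for every outcome of the random choices, 2. $\mathbb E[f(S_t)]\ge(1-C\varepsilon)\,f(V_t)$, 3. the expected total number of oracle queries made during the first $t$ updates is at most $t\cdot P(\log n,\log\rho,1/\varepsilon)$. -/

import Mathlib

/-- Randomized computations with oracle access to a set function on the ground set `Fin n`.
Such a computation either returns a value, or asks the oracle for the value of one set and
continues depending on the answer, or draws a uniformly random element of `Fin (m + 1)` and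
continues depending on the outcome. -/
inductive OracleComp (n : ℕ) (β : Type) : Type where
  | ret (b : β) : OracleComp n β
  | query (A : Finset (Fin n)) (k : ℝ → OracleComp n β) : OracleComp n β
  | rand (m : ℕ) (k : Fin (m + 1) → OracleComp n β) : OracleComp n β

/-- The joint distribution of the returned value and of the number of oracle queries made,
when the oracle answers according to `f`. -/
noncomputable def OracleComp.run {n : ℕ} {β : Type} (f : Finset (Fin n) → ℝ) :
    OracleComp n β → PMF (β × ℕ)
  | .ret b => PMF.pure (b, 0)
  | .query A k => (OracleComp.run f (k (f A))).map fun x => (x.1, x.2 + 1)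
  | .rand m k => (PMF.uniformOfFintype (Fin (m + 1))).bind fun i => OracleComp.run f (k i)

/-- An update of the set of present elements. -/
inductive Update (n : ℕ) : Type where
  | insert (v : Fin n) : Update n
  | delete (v : Fin n) : Update n

/-- The element that is inserted or deleted. -/
def Update.elem {n : ℕ} : Update n → Fin n
  | .insert v => v
  | .delete v => v

/-- The effect of an update on the set of present elements. -/
def Update.apply {n : ℕ} (V : Finset (Fin n)) : Update n → Finset (Fin n)
  | .insert v => Insert.insert v V
  | .delete v => V.erase v

/-- The set of present elements after a sequence of updates, starting from the empty set. -/
def present {n : ℕ} (us : List (Update n)) : Finset (Fin n) :=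
  us.foldl Update.apply ∅

/-- A randomized dynamic algorithm: an internal state, a procedure that handles one update
(it is told the update and the weight of the updated element; it accesses the set function only
through oracle queries), and the solution that is currently maintained. -/
structure DynamicAlgorithm (n : ℕ) where
  State : Type
  start : State
  step : State → Update n → ℝ → OracleComp n State
  solution : State → Finset (Fin n)

/-- The joint distribution of the state and of the total number of oracle queries after the
algorithm has processed, in order, a sequence of updates that was fixed in advance. -/
noncomputable def DynamicAlgorithm.exec {n : ℕ} (A : DynamicAlgorithm n) (w : Fin n → ℝ)
    (f : Finset (Fin n) → ℝ) (us : List (Update n)) : PMF (A.State × ℕ) :=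
  us.foldl
    (fun p u => p.bind fun x =>
      ((A.step x.1 u (w u.elem)).run f).map fun y => (y.1, x.2 + y.2))
    (PMF.pure (A.start, 0))

/-- Expectation of a nonnegative random variable. -/
noncomputable def expect {Ω : Type} (p : PMF Ω) (X : Ω → ENNReal) : ENNReal :=
  ∑' x, p x * X x

/-- Nonnegative, monotone, submodular set functions. -/
structure IsMonotoneSubmodular {n : ℕ} (f : Finset (Fin n) → ℝ) : Prop where
  nonneg : ∀ A, 0 ≤ f A
  mono : ∀ A B, A ⊆ B → f A ≤ f B
  submodular : ∀ A B, f (A ∪ B) + f (A ∩ B) ≤ f A + f B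

/-- The total weight of a set. -/
def cost {n : ℕ} (w : Fin n → ℝ) (S : Finset (Fin n)) : ℝ :=
  ∑ v ∈ S, w v

open Classical in
/-- The minimum cost of a set `S ⊆ V` with `f S = f V`. -/
noncomputable def optCost {n : ℕ} (w : Fin n → ℝ) (f : Finset (Fin n) → ℝ)
    (V : Finset (Fin n)) : ℝ :=
  (V.powerset.filter fun S => f S = f V).inf' ⟨V, by simp⟩ (cost w)

/-- The least weight of an element of the ground set. -/
noncomputable def minWeight {n : ℕ} (w : Fin n → ℝ) : ℝ := ⨅ v, w v

/-- The largest weight of an element of the ground set. -/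
noncomputable def maxWeight {n : ℕ} (w : Fin n → ℝ) : ℝ := ⨆ v, w v

/-- The weight ratio of the ground set. -/
noncomputable def weightRatio {n : ℕ} (w : Fin n → ℝ) : ℝ := maxWeight w / minWeight w

/-! Fix a density threshold `τ = 2 ^ z`. Suppose a solution `L` is built by adding elements of
density at least `τ`, until every present element has marginal density at most `τ`. By
submodularity, `f V - f L` is at most `τ` times the cost of an optimal cover, and the cost of `L ∩
V` is at most `(f V - f ∅) / τ`. With `τ` about `ε (f V - f ∅) / OPT`, the loss is an `ε`-fraction
and the cost is at most `2 / ε` times the optimum. Since OPT is unknown, solutions are kept for all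
relevant `z`, and the largest `z` whose solution is nearly full in value is output, intersected with
`V` (`selectSolution_spec`). An element is relevant at only `K + 1` scales, with `K` about `log (n ρ
/ ε)`.

For one scale, solutions form levels: level `j` extends level `j + 1`, leaves only `O(K 2 ^ j)`
elements undecided, and is rebuilt every `2 ^ (j - a)` relevant updates. A rebuild sorts its
candidates by marginal value into buckets, equal up to a factor two. While some bucket has at least
`2 ^ j` elements, random elements of it are added until at most half of it still passes the test,
the stopping position being found by binary search. A potential argument bounds the number of
rounds. A rebuild costs `2 ^ j` queries up to polynomial factors, hence about `2 ^ a` per update.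

Deletions are harmless in expectation. The adversary is oblivious, so the set `D` of elements absent
at the final time is fixed. Fewer than `2 ^ (j - a)` elements present at the last rebuild of level
`j` have been deleted since, so `D` meets at most a `2 ^ (-a)` fraction of any bucket treated there.
As long as at least half of the bucket passes, the expected value contributed by `D` is at most `δ =
4 / 2 ^ a` times the expected total gain: the chain sum with coefficients `δ - ind D` is a
submartingale (`le_E_grow`). Telescoping over the levels (`E_scale_nonneg`) bounds the loss at one
scale. The output scale depends on the random choices, so the losses of all `K + 1` scales are
added, and `a` is chosen with `8 (K + 1) ≤ ε 2 ^ a` (`E_loss_le`). -/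

/-! ### Calculus of oracle computations: guarantees for every outcome, and expectations -/

namespace OracleComp

variable {n : ℕ} {α β : Type}

/-- Sequential composition. -/
def bind : OracleComp n α → (α → OracleComp n β) → OracleComp n β
  | .ret a, k => k a
  | .query A g, k => .query A fun r => (g r).bind k
  | .rand m g, k => .rand m fun i => (g i).bind k

theorem run_bind (f : Finset (Fin n) → ℝ) (c : OracleComp n α) (k : α → OracleComp n β) :
    (c.bind k).run f =
      (c.run f).bind fun x => ((k x.1).run f).map fun y => (y.1, x.2 + y.2) := by
  induction c with
  | ret a =>
    simp only [bind, run, PMF.pure_bind, zero_add]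
    exact (PMF.map_id _).symm
  | query A g ih =>
    simp only [bind, run, ih, PMF.map_bind, PMF.bind_map, PMF.map_comp]
    congr 1
    funext x
    simp only [Function.comp_apply]
    congr 1
    funext y
    simp [Function.comp, add_right_comm]
  | rand m g ih => simp only [bind, run, ih, PMF.bind_bind]

/-- Whatever the random choices, at most `N` queries are made and the returned value
satisfies `Q`. -/
def Ensures (f : Finset (Fin n) → ℝ) : OracleComp n α → ℕ → (α → Prop) → Prop
  | .ret a, _, Q => Q a
  | .query A g, N, Q => ∃ M, M + 1 ≤ N ∧ (g (f A)).Ensures f M Q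
  | .rand _ g, N, Q => ∀ i, (g i).Ensures f N Q

/-- Expectation of a function of the returned value. -/
noncomputable def E (f : Finset (Fin n) → ℝ) : OracleComp n α → (α → ℝ) → ℝ
  | .ret a, X => X a
  | .query A g, X => (g (f A)).E f X
  | .rand m g, X => (∑ i, (g i).E f X) / (m + 1)

variable {f : Finset (Fin n) → ℝ}

theorem Ensures.mono {c : OracleComp n α} {N N' : ℕ} {Q Q' : α → Prop} (h : c.Ensures f N Q)
    (hN : N ≤ N') (hQ : ∀ a, Q a → Q' a) : c.Ensures f N' Q' := by
  induction c generalizing N N' with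
  | ret a => exact hQ _ h
  | query A g ih =>
    obtain ⟨M, hM, h⟩ := h
    exact ⟨M, hM.trans hN, ih _ h le_rfl⟩
  | rand m g ih => exact fun i => ih i (h i) hN

theorem Ensures.bind {c : OracleComp n α} {k : α → OracleComp n β} {N M : ℕ} {Q : α → Prop}
    {R : β → Prop} (h : c.Ensures f N Q) (hk : ∀ a, Q a → (k a).Ensures f M R) :
    (c.bind k).Ensures f (N + M) R := by
  induction c generalizing N with
  | ret a => exact (hk a h).mono (by omega) fun _ => id
  | query A g ih =>
    obtain ⟨N', hN, h⟩ := h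
    exact ⟨N' + M, by omega, ih _ h⟩
  | rand m g ih => exact fun i => ih i (h i)

theorem E_bind (c : OracleComp n α) (k : α → OracleComp n β) (X : β → ℝ) :
    (c.bind k).E f X = c.E f fun a => (k a).E f X := by
  induction c with
  | ret a => rfl
  | query A g ih => exact ih _
  | rand m g ih => simp only [OracleComp.bind, E, ih]

theorem E_const (c : OracleComp n α) (r : ℝ) : (c.E f fun _ => r) = r := by
  induction c with
  | ret a => rfl
  | query A g ih => exact ih _
  | rand m g ih =>
    simp only [E, ih, Finset.sum_const, Finset.card_univ, Fintype.card_fin, nsmul_eq_mul]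
    push_cast
    field_simp

theorem E_add (c : OracleComp n α) (X Y : α → ℝ) :
    (c.E f fun a => X a + Y a) = c.E f X + c.E f Y := by
  induction c with
  | ret a => rfl
  | query A g ih => exact ih _
  | rand m g ih => simp only [E, ih, Finset.sum_add_distrib, add_div]

theorem E_mul (c : OracleComp n α) (r : ℝ) (X : α → ℝ) :
    (c.E f fun a => r * X a) = r * c.E f X := by
  induction c with
  | ret a => rfl
  | query A g ih => exact ih _
  | rand m g ih => simp only [E, ih, ← Finset.mul_sum, mul_div_assoc]

theorem E_sub (c : OracleComp n α) (X Y : α → ℝ) :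
    (c.E f fun a => X a - Y a) = c.E f X - c.E f Y := by
  have h := E_add (f := f) c (fun a => X a - Y a) Y
  simp only [sub_add_cancel] at h
  linarith

theorem E_sum {ι : Type*} (c : OracleComp n α) (s : Finset ι) (X : ι → α → ℝ) :
    (c.E f fun a => ∑ i ∈ s, X i a) = ∑ i ∈ s, c.E f (X i) := by
  classical
  induction s using Finset.induction_on with
  | empty => simpa using E_const c 0
  | insert i s hi ih => simp only [Finset.sum_insert hi, E_add, ih]

theorem Ensures.E_mono {c : OracleComp n α} {N : ℕ} {Q : α → Prop} (h : c.Ensures f N Q)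
    {X Y : α → ℝ} (hXY : ∀ a, Q a → X a ≤ Y a) : c.E f X ≤ c.E f Y := by
  induction c generalizing N with
  | ret a => exact hXY a h
  | query A g ih =>
    obtain ⟨M, hM, h⟩ := h
    exact ih _ h
  | rand m g ih =>
    exact div_le_div_of_nonneg_right (Finset.sum_le_sum fun i _ => ih i (h i)) (by positivity)

theorem Ensures.E_congr {c : OracleComp n α} {N : ℕ} {Q : α → Prop} (h : c.Ensures f N Q)
    {X Y : α → ℝ} (hXY : ∀ a, Q a → X a = Y a) : c.E f X = c.E f Y :=
  le_antisymm (h.E_mono fun a ha => (hXY a ha).le) (h.E_mono fun a ha => (hXY a ha).ge)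

theorem Ensures.le_E {c : OracleComp n α} {N : ℕ} {Q : α → Prop} (h : c.Ensures f N Q)
    {X : α → ℝ} {r : ℝ} (hX : ∀ a, Q a → r ≤ X a) : r ≤ c.E f X := by
  simpa only [E_const] using h.E_mono (X := fun _ => r) hX

/-- Transfers guarantees proved by recursion on the computation to its distribution. It yields the
cost bound for every outcome, and a query bound that is worst-case, hence stronger than one in
expectation. -/
theorem Ensures.of_mem_support {c : OracleComp n α} {N : ℕ} {Q : α → Prop}
    (h : c.Ensures f N Q) {x : α × ℕ} (hx : x ∈ (c.run f).support) : Q x.1 ∧ x.2 ≤ N := by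
  induction c generalizing N x with
  | ret a =>
    simp only [run, PMF.support_pure, Set.mem_singleton_iff] at hx
    subst hx
    exact ⟨h, Nat.zero_le _⟩
  | query A g ih =>
    obtain ⟨M, hM, h⟩ := h
    simp only [run, PMF.support_map, Set.mem_image] at hx
    obtain ⟨y, hy, rfl⟩ := hx
    have := ih _ h hy
    exact ⟨this.1, by simp only; omega⟩
  | rand m g ih =>
    simp only [run, PMF.mem_support_bind_iff] at hx
    obtain ⟨i, -, hi⟩ := hx
    exact ih i (h i) hi

end OracleComp

/-! ### Comparison with expectations of probability mass functions -/

theorem expect_map {Ω Ω' : Type} (p : PMF Ω) (g : Ω → Ω') (X : Ω' → ENNReal) :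
    expect (p.map g) X = expect p fun x => X (g x) := by
  classical
  simp only [expect, PMF.map_apply, ← ENNReal.tsum_mul_right]
  rw [ENNReal.tsum_comm]
  refine tsum_congr fun a => ?_
  rw [tsum_eq_single (g a)]
  · simp
  · intro b hb
    simp [hb]

theorem expect_bind {Ω Ω' : Type} (p : PMF Ω) (q : Ω → PMF Ω') (X : Ω' → ENNReal) :
    expect (p.bind q) X = expect p fun x => expect (q x) X := by
  simp only [expect, PMF.bind_apply, ← ENNReal.tsum_mul_right, ← ENNReal.tsum_mul_left]
  rw [ENNReal.tsum_comm]
  simp only [mul_assoc]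

theorem expect_le_of_forall_mem_support {Ω : Type} (p : PMF Ω) (X : Ω → ENNReal) (r : ENNReal)
    (h : ∀ x ∈ p.support, X x ≤ r) : expect p X ≤ r := by
  calc expect p X ≤ ∑' x, p x * r := by
        refine ENNReal.tsum_le_tsum fun x => ?_
        by_cases hx : p x = 0
        · simp [hx]
        · exact mul_le_mul_right (h x ((PMF.mem_support_iff _ _).2 hx)) _
    _ = r := by rw [ENNReal.tsum_mul_right, p.tsum_coe, one_mul]

namespace OracleComp

variable {n : ℕ} {α β : Type} {f : Finset (Fin n) → ℝ}

theorem expect_run (c : OracleComp n α) (X : α → ℝ) (hX : ∀ a, 0 ≤ X a) :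
    expect (c.run f) (fun x => ENNReal.ofReal (X x.1)) = ENNReal.ofReal (c.E f X) := by
  have nonneg : ∀ c : OracleComp n α, 0 ≤ c.E f X := by
    intro c
    induction c with
    | ret a => exact hX a
    | query A g ih => exact ih _
    | rand m g ih => exact div_nonneg (Finset.sum_nonneg fun i _ => ih i) (by positivity)
  induction c with
  | ret a =>
    classical
    rw [run, E, expect, tsum_eq_single (a, 0)]
    · simp
    · intro b hb
      simp [PMF.pure_apply, hb]
  | query A g ih => simp only [run, E, expect_map, ih]
  | rand m g ih =>
    simp only [run, E, expect_bind, ih]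
    rw [expect, tsum_fintype, ENNReal.ofReal_div_of_pos (by positivity),
      ENNReal.ofReal_sum_of_nonneg fun i _ => nonneg _]
    simp only [PMF.uniformOfFintype_apply, ← Finset.mul_sum, Fintype.card_fin]
    rw [mul_comm, div_eq_mul_inv]
    congr 2
    rw [← Nat.cast_succ, ENNReal.ofReal_natCast]

/-! ### Building blocks: batches of queries, uniform sampling, independent components -/

/-- Queries a list of sets; the returned function agrees with the oracle on that list. -/
noncomputable def ask : List (Finset (Fin n)) → OracleComp n (Finset (Fin n) → ℝ)
  | [] => .ret fun _ => 0
  | A :: l => .query A fun r => (ask l).bind fun g => .ret (Function.update g A r)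

theorem ensures_ask (l : List (Finset (Fin n))) :
    (ask l).Ensures f l.length fun g => ∀ A ∈ l, g A = f A := by
  induction l with
  | nil => intro A hA; simp at hA
  | cons A l ih =>
    refine ⟨l.length, le_rfl, (ih.bind (M := 0) fun g hg => ?_)⟩
    intro B hB
    by_cases h : B = A
    · subst h; simp
    · rw [Function.update_of_ne h]
      exact hg B (by simpa [h] using hB)

theorem Ensures.ask_bind {l : List (Finset (Fin n))} {k : (Finset (Fin n) → ℝ) → OracleComp n α}
    {N : ℕ} {Q : α → Prop} (hk : ∀ g, (∀ A ∈ l, g A = f A) → (k g).Ensures f N Q) :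
    ((ask l).bind k).Ensures f (l.length + N) Q :=
  (ensures_ask l).bind hk

/-- The algorithm computes with the reported function `g`. Knowing that `g` agrees with `f` on the
queried sets is enough to replace `g` by `f` in the analysis. -/
theorem le_E_ask_bind {l : List (Finset (Fin n))} {k : (Finset (Fin n) → ℝ) → OracleComp n α}
    {r : ℝ} {X : α → ℝ} (hk : ∀ g, (∀ A ∈ l, g A = f A) → r ≤ (k g).E f X) :
    r ≤ ((ask l).bind k).E f X := by
  rw [E_bind]
  exact (ensures_ask l).le_E hk

/-- A uniformly random element of a nonempty set. -/
noncomputable def sample (s : Finset (Fin n)) (hs : s.Nonempty) : OracleComp n (Fin n) :=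
  .rand (s.card - 1) fun i =>
    .ret (s.equivFin.symm (Fin.cast (Nat.sub_add_cancel hs.card_pos) i))

theorem ensures_sample (s : Finset (Fin n)) (hs : s.Nonempty) :
    (sample s hs).Ensures f 0 (· ∈ s) :=
  fun _ => Finset.coe_mem _

theorem E_sample (s : Finset (Fin n)) (hs : s.Nonempty) (X : Fin n → ℝ) :
    (sample s hs).E f X = (∑ x ∈ s, X x) / s.card := by
  have hc : s.card - 1 + 1 = s.card := Nat.sub_add_cancel hs.card_pos
  simp only [sample, E]
  congr 1
  · rw [← Finset.sum_coe_sort s]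
    exact Fintype.sum_equiv ((finCongr hc).trans s.equivFin.symm) _ _ fun i => rfl
  · exact_mod_cast hc

/-- Runs, one after the other, a procedure for each of the listed components of a family. -/
def forEach {ι σ : Type} [DecidableEq ι] (body : ι → σ → OracleComp n σ) :
    List ι → (ι → σ) → OracleComp n (ι → σ)
  | [], I => .ret I
  | z :: l, I => (body z (I z)).bind fun s => forEach body l (Function.update I z s)

section forEach

variable {ι σ : Type} [DecidableEq ι] {body : ι → σ → OracleComp n σ}

theorem ensures_forEach {l : List ι} (hl : l.Nodup) {I : ι → σ} {N : ι → ℕ}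
    {Q : ι → σ → Prop} (h : ∀ z ∈ l, (body z (I z)).Ensures f (N z) (Q z)) :
    (forEach body l I).Ensures f (l.map N).sum
      fun I' => (∀ z ∈ l, Q z (I' z)) ∧ ∀ z ∉ l, I' z = I z := by
  induction l generalizing I with
  | nil => exact ⟨by simp, fun _ _ => rfl⟩
  | cons z l ih =>
    rw [List.nodup_cons] at hl
    rw [List.map_cons, List.sum_cons]
    refine (h z (by simp)).bind fun s hs => ?_
    refine (ih hl.2 (I := Function.update I z s) fun y hy => ?_).mono le_rfl fun I' hI' => ⟨?_, ?_⟩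
    · have : y ≠ z := fun e => hl.1 (e ▸ hy)
      rw [Function.update_of_ne this]
      exact h y (by simp [hy])
    · intro y hy
      rcases List.mem_cons.1 hy with rfl | hy
      · rw [hI'.2 _ hl.1, Function.update_self]
        exact hs
      · exact hI'.1 y hy
    · intro y hy
      rw [List.mem_cons, not_or] at hy
      rw [hI'.2 _ hy.2, Function.update_of_ne hy.1]

theorem E_forEach_of_notMem {l : List ι} {z : ι} (hz : z ∉ l) (I : ι → σ) (X : σ → ℝ) :
    ((forEach body l I).E f fun I' => X (I' z)) = X (I z) := by
  induction l generalizing I with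
  | nil => rfl
  | cons y l ih =>
    rw [List.mem_cons, not_or] at hz
    simp only [forEach, E_bind, ih hz.2, Function.update_of_ne hz.1, E_const]

/-- Each body reads and writes only its own component, so a single component can be analysed as if
the others were not run. -/
theorem E_forEach_of_mem {l : List ι} (hl : l.Nodup) {z : ι} (hz : z ∈ l) (I : ι → σ)
    (X : σ → ℝ) : ((forEach body l I).E f fun I' => X (I' z)) = (body z (I z)).E f X := by
  induction l generalizing I with
  | nil => simp at hz
  | cons y l ih =>
    rw [List.nodup_cons] at hl
    rw [forEach, E_bind]
    rcases List.mem_cons.1 hz with rfl | hz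
    · simp only [E_forEach_of_notMem hl.1, Function.update_self]
    · have : z ≠ y := fun e => hl.1 (e ▸ hz)
      simp only [ih hl.2 hz, Function.update_of_ne this, E_const]

end forEach

end OracleComp

/-! ### A whole run as one oracle computation -/

/-- The computation performed by a dynamic algorithm on a whole sequence of updates. -/
def DynamicAlgorithm.comp {n : ℕ} (A : DynamicAlgorithm n) (w : Fin n → ℝ)
    (us : List (Update n)) : OracleComp n A.State :=
  us.foldl (fun c u => c.bind fun s => A.step s u (w u.elem)) (.ret A.start)

theorem DynamicAlgorithm.exec_eq_run_comp {n : ℕ} (A : DynamicAlgorithm n) (w : Fin n → ℝ)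
    (f : Finset (Fin n) → ℝ) (us : List (Update n)) :
    A.exec w f us = (A.comp w us).run f := by
  induction us using List.reverseRecOn with
  | nil => rfl
  | append_singleton us u ih =>
    simp only [exec, comp, List.foldl_append, List.foldl_cons, List.foldl_nil,
      OracleComp.run_bind] at ih ⊢
    rw [ih]

theorem DynamicAlgorithm.comp_concat {n : ℕ} (A : DynamicAlgorithm n) (w : Fin n → ℝ)
    (us : List (Update n)) (u : Update n) :
    A.comp w (us ++ [u]) = (A.comp w us).bind fun s => A.step s u (w u.elem) := by
  simp [comp]

/-! ### Marginal values and sums along chains of insertions -/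

/-- The marginal value of an element with respect to a set. -/
def gain {n : ℕ} (f : Finset (Fin n) → ℝ) (S : Finset (Fin n)) (v : Fin n) : ℝ :=
  f (insert v S) - f S

namespace IsMonotoneSubmodular

variable {n : ℕ} {f : Finset (Fin n) → ℝ} (hf : IsMonotoneSubmodular f)

include hf

theorem gain_nonneg (S : Finset (Fin n)) (v : Fin n) : 0 ≤ gain f S v :=
  sub_nonneg.2 (hf.mono _ _ (Finset.subset_insert _ _))

theorem gain_anti {S T : Finset (Fin n)} (h : S ⊆ T) (v : Fin n) : gain f T v ≤ gain f S v := by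
  by_cases hv : v ∈ T
  · rw [gain, Finset.insert_eq_of_mem hv, sub_self]
    exact hf.gain_nonneg S v
  · have := hf.submodular (insert v S) T
    rw [Finset.insert_union, Finset.union_eq_right.2 h, Finset.insert_inter_of_notMem hv,
      Finset.inter_eq_left.2 h] at this
    simp only [gain]
    linarith

theorem le_add_sum_gain (S T : Finset (Fin n)) : f T ≤ f S + ∑ v ∈ T, gain f S v := by
  suffices h : f (S ∪ T) ≤ f S + ∑ v ∈ T, gain f S v from
    (hf.mono _ _ Finset.subset_union_right).trans h
  induction T using Finset.induction_on with
  | empty => simp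
  | insert v T hv ih =>
    rw [Finset.sum_insert hv, Finset.union_insert]
    have h1 := hf.gain_anti (S := S) (T := S ∪ T) Finset.subset_union_left v
    rw [gain] at h1
    linarith

end IsMonotoneSubmodular

theorem gain_of_mem {n : ℕ} (f : Finset (Fin n) → ℝ) {S : Finset (Fin n)} {v : Fin n}
    (hv : v ∈ S) : gain f S v = 0 := by
  rw [gain, Finset.insert_eq_of_mem hv, sub_self]

/-- The sum over a list, whose elements are added one at a time starting from its end, of the
marginal values weighted by the coefficients `c`. -/
def chainSum {n : ℕ} (f : Finset (Fin n) → ℝ) (c : Fin n → ℝ) : List (Fin n) → ℝ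
  | [] => 0
  | x :: l => gain f l.toFinset x * c x + chainSum f c l

/-- Each element of the list has density at least `τ` when it is added. -/
def DenseChain {n : ℕ} (f : Finset (Fin n) → ℝ) (τ : ℝ) (w : Fin n → ℝ) : List (Fin n) → Prop
  | [] => True
  | x :: l => τ * w x ≤ gain f l.toFinset x ∧ DenseChain f τ w l

section

variable {n : ℕ} {f : Finset (Fin n) → ℝ}

theorem DenseChain.congr {τ : ℝ} {w w' : Fin n → ℝ} {l : List (Fin n)} (h : DenseChain f τ w l)
    (hw : ∀ x ∈ l, w x = w' x) : DenseChain f τ w' l := by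
  induction l with
  | nil => trivial
  | cons x l ih =>
    refine ⟨?_, ih h.2 fun y hy => hw y (by simp [hy])⟩
    rw [← hw x (by simp)]
    exact h.1

theorem chainSum_one (l : List (Fin n)) :
    chainSum f (fun _ => 1) l = f l.toFinset - f ∅ := by
  induction l with
  | nil => simp [chainSum]
  | cons x l ih => simp [chainSum, ih, gain]

theorem chainSum_linear (a b : ℝ) (c d : Fin n → ℝ) (l : List (Fin n)) :
    chainSum f (fun x => a * c x + b * d x) l = a * chainSum f c l + b * chainSum f d l := by
  induction l with
  | nil => simp [chainSum]
  | cons x l ih => simp only [chainSum, ih]; ring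

theorem chainSum_nonneg (hf : IsMonotoneSubmodular f) {c : Fin n → ℝ} (hc : ∀ x, 0 ≤ c x)
    (l : List (Fin n)) : 0 ≤ chainSum f c l := by
  induction l with
  | nil => simp [chainSum]
  | cons x l ih => exact add_nonneg (mul_nonneg (hf.gain_nonneg _ _) (hc x)) ih

/-- The indicator function of a set. -/
noncomputable def ind (V : Finset (Fin n)) (x : Fin n) : ℝ := if x ∈ V then 1 else 0

theorem ind_nonneg (V : Finset (Fin n)) (x : Fin n) : 0 ≤ ind V x := by
  unfold ind; split_ifs <;> norm_num

theorem ind_compl (V : Finset (Fin n)) (x : Fin n) : ind Vᶜ x = 1 - ind V x := by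
  unfold ind; by_cases h : x ∈ V <;> simp [h]

/-- Dropping the elements outside `V` from the chain only increases the marginal values of those in
`V`. -/
theorem chainSum_ind_le (hf : IsMonotoneSubmodular f) (V : Finset (Fin n)) (l : List (Fin n)) :
    chainSum f (ind V) l ≤ f (l.toFinset ∩ V) - f ∅ := by
  induction l with
  | nil => simp [chainSum]
  | cons x l ih =>
    rw [chainSum, List.toFinset_cons, ind]
    split_ifs with hx
    · rw [Finset.insert_inter_of_mem hx]
      have := hf.gain_anti (Finset.inter_subset_left (s₁ := l.toFinset) (s₂ := V)) x
      simp only [gain] at this ⊢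
      linarith
    · rw [Finset.insert_inter_of_notMem hx]
      linarith

/-- Each element paid for its weight, at rate `τ`, when it was added. Restricting to `V` makes the
cost bound independent of how much of the chain has been deleted. -/
theorem DenseChain.cost_le {τ : ℝ} {w : Fin n → ℝ} (hτ : 0 ≤ τ) (hw : ∀ v, 0 < w v)
    {l : List (Fin n)} (h : DenseChain f τ w l) (V : Finset (Fin n)) :
    τ * cost w (l.toFinset ∩ V) ≤ chainSum f (ind V) l := by
  induction l with
  | nil => simp [cost, chainSum]
  | cons x l ih =>
    have ih := ih h.2
    rw [chainSum, List.toFinset_cons, ind]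
    split_ifs with hx
    · rw [Finset.insert_inter_of_mem hx]
      -- The list is not assumed to be free of repetitions.
      have h1 : cost w (insert x (l.toFinset ∩ V)) ≤ w x + cost w (l.toFinset ∩ V) := by
        by_cases hm : x ∈ l.toFinset ∩ V
        · rw [Finset.insert_eq_of_mem hm]
          linarith [hw x]
        · rw [cost, Finset.sum_insert hm, cost]
      have h2 := mul_le_mul_of_nonneg_left h1 hτ
      have h3 := h.1
      linarith
    · rw [Finset.insert_inter_of_notMem hx]
      linarith

/-- The marginal values add up to `f l.toFinset - f ∅`, and the share of `V` is at most `f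
(l.toFinset ∩ V) - f ∅`. Hence the share of the complement bounds the loss caused by deletions. -/
theorem le_inter_add_chainSum (hf : IsMonotoneSubmodular f) (V : Finset (Fin n))
    (l : List (Fin n)) : f l.toFinset ≤ f (l.toFinset ∩ V) + chainSum f (ind Vᶜ) l := by
  have h1 := chainSum_one (f := f) l
  have h2 := chainSum_linear (f := f) 1 1 (ind V) (ind Vᶜ) l
  have h3 : (fun x => 1 * ind V x + 1 * ind Vᶜ x) = fun _ => (1 : ℝ) := by
    funext x
    rw [ind_compl]; ring
  rw [h3, h1] at h2
  linarith [chainSum_ind_le hf V l]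

end

/-! ### The threshold test -/

section passSet

variable {n : ℕ}

open Classical in
/-- The elements of `C` whose marginal value is at least `θ` and whose density is at least `τ`. -/
noncomputable def passSet (f : Finset (Fin n) → ℝ) (τ : ℝ) (w : Fin n → ℝ) (θ : ℝ)
    (S C : Finset (Fin n)) : Finset (Fin n) :=
  C.filter fun v => θ ≤ gain f S v ∧ τ * w v ≤ gain f S v

variable {f : Finset (Fin n) → ℝ} {τ : ℝ} {w : Fin n → ℝ} {θ : ℝ} {S T C : Finset (Fin n)}

theorem mem_passSet {v : Fin n} :
    v ∈ passSet f τ w θ S C ↔ v ∈ C ∧ θ ≤ gain f S v ∧ τ * w v ≤ gain f S v := by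
  simp [passSet]

theorem passSet_anti (hf : IsMonotoneSubmodular f) (h : S ⊆ T) :
    passSet f τ w θ T C ⊆ passSet f τ w θ S C := fun v hv => by
  rw [mem_passSet] at hv ⊢
  have := hf.gain_anti h v
  exact ⟨hv.1, hv.2.1.trans this, hv.2.2.trans this⟩

theorem notMem_passSet_of_mem (hθ : 0 < θ) {v : Fin n} (hv : v ∈ S) :
    v ∉ passSet f τ w θ S C := fun h => by
  rw [mem_passSet, gain_of_mem f hv] at h
  linarith [h.2.1]

/-- The sets whose values determine the marginal values of the elements of `C`. -/
noncomputable def gainSets (S C : Finset (Fin n)) : List (Finset (Fin n)) :=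
  S :: C.toList.map fun v => insert v S

theorem length_gainSets (S C : Finset (Fin n)) : (gainSets S C).length = C.card + 1 := by
  simp [gainSets]

theorem passSet_congr {g : Finset (Fin n) → ℝ} (h : ∀ A ∈ gainSets S C, g A = f A) :
    passSet g τ w θ S C = passSet f τ w θ S C := by
  ext v
  simp only [mem_passSet, and_congr_right_iff]
  intro hv
  rw [gain, gain, h S (by simp [gainSets]), h (insert v S) (by
    simp only [gainSets, List.mem_cons, List.mem_map, Finset.mem_toList]
    exact Or.inr ⟨v, hv, rfl⟩)]

end passSet

/-! ### Treating one bucket: random insertions and binary search -/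

namespace OracleComp

variable {n : ℕ} (τ : ℝ) (w : Fin n → ℝ) (θ : ℝ)

/-- Adds the element `x` to the list if it passes the test for the threshold `θ`. -/
noncomputable def extend (f : Finset (Fin n) → ℝ) (L : List (Fin n)) (x : Fin n) :
    List (Fin n) :=
  if x ∈ passSet f τ w θ L.toFinset {x} then x :: L else L

/-- Goes through (at most `k` elements of) `R` in random order, adds those elements that pass the
test for the threshold `θ`, and returns the list of all intermediate solutions. -/
noncomputable def grow : ℕ → List (Fin n) → Finset (Fin n) → OracleComp n (List (List (Fin n)))
  | 0, L, _ => .ret [L]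
  | k + 1, L, R =>
    if h : R.Nonempty then
      (sample R h).bind fun x =>
        (ask (gainSets L.toFinset {x})).bind fun g =>
          (grow k (extend τ w θ g L x) (R.erase x)).bind fun l => .ret (L :: l)
    else .ret [L]

/-- Binary search, among the positions from `lo` to `hi`, for the first solution with respect to
which at most half of the elements of `C` pass the test. -/
noncomputable def search (C : Finset (Fin n)) (l : List (List (Fin n))) :
    ℕ → ℕ → ℕ → OracleComp n ℕ
  | 0, _, hi => .ret hi
  | d + 1, lo, hi =>
    (ask (gainSets (l.getD ((lo + hi) / 2) []).toFinset C)).bind fun g =>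
      if 2 * (passSet g τ w θ (l.getD ((lo + hi) / 2) []).toFinset C).card ≤ C.card then
        search C l d lo ((lo + hi) / 2)
      else search C l d ((lo + hi) / 2 + 1) hi

/-- Adds random elements of `C` until at most half of `C` passes the test. -/
noncomputable def layer (d : ℕ) (C : Finset (Fin n)) (L : List (Fin n)) :
    OracleComp n (List (Fin n)) :=
  (grow τ w θ C.card L C).bind fun l =>
    (search τ w θ C l d 0 C.card).bind fun i => .ret (l.getD i [])

variable {τ w θ} {f g : Finset (Fin n) → ℝ}

theorem extend_congr {L : List (Fin n)} {x : Fin n}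
    (h : ∀ A ∈ gainSets L.toFinset {x}, g A = f A) : extend τ w θ g L x = extend τ w θ f L x := by
  rw [extend, extend, passSet_congr h]

theorem subset_extend (L : List (Fin n)) (x : Fin n) : L ⊆ extend τ w θ f L x := by
  unfold extend
  split_ifs
  · exact List.subset_cons_self _ _
  · exact List.Subset.refl _

theorem toFinset_subset {L L' : List (Fin n)} (h : L ⊆ L') : L.toFinset ⊆ L'.toFinset :=
  fun x hx => by simpa using h (by simpa using hx)

theorem mem_of_mem_extend {L : List (Fin n)} {x y : Fin n} (h : y ∈ extend τ w θ f L x) :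
    y ∈ L ∨ y = x := by
  unfold extend at h
  split_ifs at h
  · exact (List.mem_cons.1 h).symm
  · exact Or.inl h

theorem DenseChain.extend {L : List (Fin n)} (h : DenseChain f τ w L) (x : Fin n) :
    DenseChain f τ w (extend τ w θ f L x) := by
  unfold OracleComp.extend
  split_ifs with hx
  · exact ⟨(mem_passSet.1 hx).2.2, h⟩
  · exact h

/-- The drawn element never passes again: it either failed already, or now lies in the solution and
has marginal value `0 < θ`. So every element that still passes is among those not yet drawn. -/
theorem passSet_extend_subset (hf : IsMonotoneSubmodular f) (hθ : 0 < θ) {L : List (Fin n)}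
    {C R : Finset (Fin n)} (h : passSet f τ w θ L.toFinset C ⊆ R) (x : Fin n) :
    passSet f τ w θ (extend τ w θ f L x).toFinset C ⊆ R.erase x := by
  intro y hy
  have hy' := passSet_anti hf (toFinset_subset (subset_extend (τ := τ) (w := w) (θ := θ) (f := f)
    L x)) hy
  refine Finset.mem_erase.2 ⟨?_, h hy'⟩
  rintro rfl
  have h1 : y ∈ passSet f τ w θ L.toFinset {y} := by
    rw [mem_passSet] at hy' ⊢
    exact ⟨by simp, hy'.2⟩
  exact notMem_passSet_of_mem hθ (by simp [extend, h1]) hy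

theorem ensures_grow (hf : IsMonotoneSubmodular f) (hθ : 0 < θ) {C : Finset (Fin n)} (k : ℕ)
    {L : List (Fin n)} {R : Finset (Fin n)} (hk : R.card = k) (hRC : R ⊆ C)
    (hR : passSet f τ w θ L.toFinset C ⊆ R) (hL : DenseChain f τ w L) :
    (grow τ w θ k L R).Ensures f (2 * k) fun l =>
      l.length = k + 1 ∧ l.Pairwise (· ⊆ ·) ∧
      (∀ L' ∈ l, L ⊆ L' ∧ (∀ x ∈ L', x ∈ L ∨ x ∈ C) ∧ DenseChain f τ w L') ∧
      passSet f τ w θ (l.getD k []).toFinset C = ∅ := by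
  induction k generalizing L R with
  | zero =>
    refine ⟨rfl, List.pairwise_singleton _ _, ?_, ?_⟩
    · intro L' hL'
      rw [List.mem_singleton] at hL'
      subst hL'
      exact ⟨List.Subset.refl _, fun x hx => Or.inl hx, hL⟩
    · rw [Finset.card_eq_zero] at hk
      subst hk
      exact Finset.subset_empty.1 hR
  | succ k ih =>
    have hne : R.Nonempty := by
      rw [← Finset.card_pos]; omega
    rw [grow, dif_pos hne]
    refine ((ensures_sample R hne).bind (M := 2 * k + 2) fun x hx => ?_).mono (by omega) fun _ => id
    refine (Ensures.ask_bind (N := 2 * k) fun g hg => ?_).mono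
      (by rw [length_gainSets, Finset.card_singleton]; omega) fun _ => id
    rw [extend_congr hg]
    refine ((ih (by rw [Finset.card_erase_of_mem hx]; omega)
      ((Finset.erase_subset _ _).trans hRC) (passSet_extend_subset hf hθ hR x)
      (DenseChain.extend hL x)).bind (M := 0) fun l hl => ?_)
    obtain ⟨h1, h2, h3, h4⟩ := hl
    have hsub : ∀ L' ∈ l, L ⊆ L' := fun L' hL' =>
      List.Subset.trans (subset_extend L x) (h3 L' hL').1
    refine ⟨by simp [h1], List.pairwise_cons.2 ⟨hsub, h2⟩, ?_, by simpa using h4⟩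
    intro L' hL'
    rcases List.mem_cons.1 hL' with rfl | hL'
    · exact ⟨List.Subset.refl _, fun x hx => Or.inl hx, hL⟩
    · refine ⟨hsub _ hL', fun y hy => ?_, (h3 L' hL').2.2⟩
      rcases (h3 L' hL').2.1 y hy with hy | hy
      · rcases mem_of_mem_extend hy with hy | rfl
        · exact Or.inl hy
        · exact Or.inr (hRC hx)
      · exact Or.inr hy

/-- Loop invariant of the bisection: `P` holds at `hi`, fails everywhere below `lo`, and fewer than
`2 ^ d` steps separate the two. -/
theorem ensures_search {C : Finset (Fin n)} {l : List (List (Fin n))} {P : ℕ → Prop}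
    (hP : ∀ i, P i ↔ 2 * (passSet f τ w θ (l.getD i []).toFinset C).card ≤ C.card) {b : ℕ}
    (hmono : ∀ i j, i ≤ j → j ≤ b → P i → P j) (d : ℕ) {lo hi : ℕ} (h1 : lo ≤ hi) (hb : hi ≤ b)
    (h2 : hi < lo + 2 ^ d) (h3 : P hi) (h4 : ∀ i < lo, ¬ P i) :
    (search τ w θ C l d lo hi).Ensures f (d * (C.card + 1))
      fun r => r ≤ b ∧ P r ∧ ∀ i < r, ¬ P i := by
  induction d generalizing lo hi with
  | zero =>
    have : hi = lo := by simp at h2; omega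
    subst this
    exact ⟨hb, h3, h4⟩
  | succ d ih =>
    have hmid : (lo + hi) / 2 ≤ hi := by omega
    have hmid' : lo ≤ (lo + hi) / 2 := by omega
    have hpow : 2 ^ (d + 1) = 2 ^ d + 2 ^ d := by ring
    refine (Ensures.ask_bind (N := d * (C.card + 1)) fun g hg => ?_).mono
      (by rw [length_gainSets]; linarith) fun _ => id
    rw [passSet_congr hg]
    split_ifs with h
    · exact ih hmid' (hmid.trans hb) (by omega) ((hP _).2 h) h4
    · have hlt : (lo + hi) / 2 < hi := by
        refine lt_of_le_of_ne hmid fun e => h ((hP _).1 ?_)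
        rw [e]; exact h3
      refine ih hlt hb (by omega) h3 fun i hi' hPi => h ((hP _).1 ?_)
      exact hmono i _ (by omega) (hmid.trans hb) hPi

/-- The first solution in the list with respect to which at most half of the elements of `C` pass
the test. -/
noncomputable def firstHalf (f : Finset (Fin n) → ℝ) (τ : ℝ) (w : Fin n → ℝ) (θ : ℝ)
    (C : Finset (Fin n)) (l : List (List (Fin n))) : List (Fin n) :=
  (l.find? fun L => decide (2 * (passSet f τ w θ L.toFinset C).card ≤ C.card)).getD []

/-- Passing sets shrink along the increasing list, which makes bisection valid. Since nothing passes
at the last position, `firstHalf` never takes its default value here. -/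
theorem ensures_search_firstHalf (hf : IsMonotoneSubmodular f) {C : Finset (Fin n)}
    {l : List (List (Fin n))} {d : ℕ} (hd : C.card < 2 ^ d) (hlen : l.length = C.card + 1)
    (hl : l.Pairwise (· ⊆ ·)) (hlast : passSet f τ w θ (l.getD C.card []).toFinset C = ∅) :
    (search τ w θ C l d 0 C.card).Ensures f (d * (C.card + 1)) fun i =>
      l.getD i [] = firstHalf f τ w θ C l ∧ l.getD i [] ∈ l ∧
      2 * (passSet f τ w θ (l.getD i []).toFinset C).card ≤ C.card := by
  refine (ensures_search (b := C.card) (fun i => Iff.rfl) (fun i j hij hj h => ?_) d (Nat.zero_le _)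
    le_rfl (by simpa using hd) (by simp only [hlast, Finset.card_empty]; omega)
    (by simp)).mono le_rfl fun i hi => ?_
  · have : l.getD i [] ⊆ l.getD j [] := by
      rcases hij.eq_or_lt with rfl | hij
      · exact List.Subset.refl _
      · rw [List.getD_eq_getElem _ _ (by omega : i < l.length),
          List.getD_eq_getElem _ _ (by omega : j < l.length)]
        exact List.pairwise_iff_getElem.1 hl i j _ _ hij
    have h' := Finset.card_le_card (passSet_anti (τ := τ) (w := w) (θ := θ) (C := C) hf
      (toFinset_subset this))
    omega
  · obtain ⟨h1, h2, h3⟩ := hi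
    have hil : i < l.length := by omega
    refine ⟨?_, ?_, h2⟩
    · have : (l.find? fun L => decide (2 * (passSet f τ w θ L.toFinset C).card ≤ C.card)) =
          some (l.getD i []) := by
        rw [List.find?_eq_some_iff_getElem]
        refine ⟨by simpa using h2, i, hil, (List.getD_eq_getElem _ _ _).symm, fun j hj => ?_⟩
        have := h3 j hj
        rw [List.getD_eq_getElem _ _ (hj.trans hil)] at this
        simpa using this
      rw [firstHalf, this, Option.getD_some]
    · rw [List.getD_eq_getElem _ _ hil]
      exact List.getElem_mem _

theorem ensures_layer (hf : IsMonotoneSubmodular f) (hθ : 0 < θ) {C : Finset (Fin n)} {d : ℕ}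
    (hd : C.card < 2 ^ d) {L : List (Fin n)} (hL : DenseChain f τ w L) :
    (layer τ w θ d C L).Ensures f (2 * C.card + d * (C.card + 1)) fun L' =>
      L ⊆ L' ∧ (∀ x ∈ L', x ∈ L ∨ x ∈ C) ∧ DenseChain f τ w L' ∧
      2 * (passSet f τ w θ L'.toFinset C).card ≤ C.card := by
  refine (ensures_grow hf hθ C.card rfl (Finset.Subset.refl _) (Finset.filter_subset _ _) hL).bind
    fun l hl => ?_
  refine ((ensures_search_firstHalf hf hd hl.1 hl.2.1 hl.2.2.2).bind (M := 0) fun i hi => ?_)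
  have := hl.2.2.1 _ hi.2.1
  exact ⟨this.1, this.2.1, this.2.2, hi.2.2⟩

/-- Submartingale property up to the first time when at most half of `C` passes. Before that time, a
uniform draw from `R` hits more than `C.card / 2` passing elements, each worth at least `δ * θ`. It
hits at most `(D ∩ C).card` elements of `D`, each costing at most `2 * θ`. The hypothesis `hD` is
exactly the balance of the two. -/
theorem le_E_grow (hf : IsMonotoneSubmodular f) (hθ : 0 < θ) {C D : Finset (Fin n)} {δ : ℝ}
    (hδ : 0 ≤ δ) (hD : 4 * ((D ∩ C).card : ℝ) ≤ δ * C.card) (k : ℕ) {L : List (Fin n)}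
    {R : Finset (Fin n)} (hk : R.card = k) (hRC : R ⊆ C)
    (hR : passSet f τ w θ L.toFinset C ⊆ R) (hC : ∀ v ∈ C, gain f L.toFinset v ≤ 2 * θ) :
    chainSum f (fun x => δ - ind D x) L ≤
      (grow τ w θ k L R).E f fun l => chainSum f (fun x => δ - ind D x) (firstHalf f τ w θ C l) := by
  induction k generalizing L R with
  | zero =>
    rw [Finset.card_eq_zero] at hk
    subst hk
    have : passSet f τ w θ L.toFinset C = ∅ := Finset.subset_empty.1 hR
    simp [grow, E, firstHalf, this]
  | succ k ih =>
    have hne : R.Nonempty := by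
      rw [← Finset.card_pos]; omega
    rw [grow, dif_pos hne]
    by_cases hhalf : 2 * (passSet f τ w θ L.toFinset C).card ≤ C.card
    -- The process has already stopped at `L`; whatever `grow` adds afterwards is irrelevant.
    · have : ∀ l, firstHalf f τ w θ C (L :: l) = L := fun l => by
        simp [firstHalf, hhalf]
      simp only [E_bind, E, this, E_const, le_refl]
    have hcons : ∀ l, firstHalf f τ w θ C (L :: l) = firstHalf f τ w θ C l := fun l => by
      simp [firstHalf, hhalf]
    rw [E_bind]
    have step : ∀ x ∈ R, chainSum f (fun x => δ - ind D x) (extend τ w θ f L x) ≤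
        ((ask (gainSets L.toFinset {x})).bind fun g =>
          (grow τ w θ k (extend τ w θ g L x) (R.erase x)).bind fun l => .ret (L :: l)).E f
          fun l => chainSum f (fun x => δ - ind D x) (firstHalf f τ w θ C l) := by
      intro x hx
      refine le_E_ask_bind fun g hg => ?_
      rw [extend_congr hg, E_bind]
      simp only [E, hcons]
      refine ih (by rw [Finset.card_erase_of_mem hx]; omega)
        ((Finset.erase_subset _ _).trans hRC) (passSet_extend_subset hf hθ hR x) fun v hv => ?_
      exact (hf.gain_anti (toFinset_subset (subset_extend L x)) v).trans (hC v hv)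
    refine le_trans ?_ ((ensures_sample R hne).E_mono step)
    rw [E_sample, le_div_iff₀ (by exact_mod_cast hne.card_pos)]
    -- The change for one drawn element: a passing element has marginal value between `θ` and `2 *
    -- θ`, and a failing one changes nothing, so that charging it for `D` is harmless.
    have point : ∀ x ∈ R, chainSum f (fun x => δ - ind D x) L +
        ((if x ∈ passSet f τ w θ L.toFinset C then δ * θ else 0) -
          2 * θ * (if x ∈ D then 1 else 0)) ≤
        chainSum f (fun x => δ - ind D x) (extend τ w θ f L x) := by
      intro x hx
      have hiff : x ∈ passSet f τ w θ L.toFinset {x} ↔ x ∈ passSet f τ w θ L.toFinset C := by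
        simp [mem_passSet, hRC hx]
      unfold extend
      by_cases hp : x ∈ passSet f τ w θ L.toFinset C
      · rw [if_pos hp, if_pos (hiff.2 hp), chainSum, ind]
        have h1 := (mem_passSet.1 hp).2.1
        have h2 := hC x (hRC hx)
        split_ifs <;> nlinarith
      · rw [if_neg hp, if_neg fun h => hp (hiff.1 h)]
        split_ifs <;> linarith
    have total := Finset.sum_le_sum point
    rw [Finset.sum_add_distrib, Finset.sum_sub_distrib, ← Finset.mul_sum, Finset.sum_const,
      nsmul_eq_mul, Finset.sum_ite_mem, Finset.inter_eq_right.2 hR, Finset.sum_ite_mem,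
      Finset.sum_const, Finset.sum_const, nsmul_eq_mul, nsmul_eq_mul] at total
    have hle : ((R ∩ D).card : ℝ) ≤ (D ∩ C).card := by
      rw [Finset.inter_comm]
      exact_mod_cast Finset.card_le_card (Finset.inter_subset_inter_left hRC)
    have hhalf' : (C.card : ℝ) ≤ 2 * (passSet f τ w θ L.toFinset C).card := by
      exact_mod_cast (not_le.1 hhalf).le
    have e1 : 0 ≤ δ * θ := by positivity
    nlinarith [mul_le_mul_of_nonneg_left hhalf' e1, mul_le_mul_of_nonneg_left hD hθ.le,
      mul_le_mul_of_nonneg_left hle hθ.le]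

theorem le_E_layer (hf : IsMonotoneSubmodular f) (hθ : 0 < θ) {C D : Finset (Fin n)} {δ : ℝ}
    (hδ : 0 ≤ δ) (hD : 4 * ((D ∩ C).card : ℝ) ≤ δ * C.card) {d : ℕ} (hd : C.card < 2 ^ d)
    {L : List (Fin n)} (hL : DenseChain f τ w L) (hC : ∀ v ∈ C, gain f L.toFinset v ≤ 2 * θ) :
    chainSum f (fun x => δ - ind D x) L ≤
      (layer τ w θ d C L).E f fun L' => chainSum f (fun x => δ - ind D x) L' := by
  rw [layer, E_bind]
  refine (le_E_grow hf hθ hδ hD C.card rfl (Finset.Subset.refl _) (Finset.filter_subset _ _)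
    hC).trans ((ensures_grow hf hθ C.card rfl (Finset.Subset.refl _) (Finset.filter_subset _ _)
      hL).E_mono fun l hl => ?_)
  rw [E_bind]
  exact (ensures_search_firstHalf hf hd hl.1 hl.2.1 hl.2.2.2).le_E fun i hi => by
    rw [E, hi.1]

end OracleComp

/-! ### Rebuilding a level -/

namespace OracleComp

variable {n : ℕ}

/-- The elements of `W` of density at least `τ` whose marginal value lies between `τ * m * 2 ^ i`
and `τ * m * 2 ^ (i + 1)`. -/
noncomputable def bucket (f : Finset (Fin n) → ℝ) (τ : ℝ) (w : Fin n → ℝ) (m : ℝ)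
    (S W : Finset (Fin n)) (i : ℕ) : Finset (Fin n) :=
  passSet f τ w (τ * m * 2 ^ i) S W \ passSet f τ w (τ * m * 2 ^ (i + 1)) S W

section

variable (τ : ℝ) (w : Fin n → ℝ) (m : ℝ) (K d j : ℕ) (W : Finset (Fin n))

/-- Treats, at most `k` times, a bucket with at least `2 ^ j` elements. -/
noncomputable def improve : ℕ → List (Fin n) → OracleComp n (List (Fin n))
  | 0, L => .ret L
  | k + 1, L =>
    (ask (gainSets L.toFinset W)).bind fun g =>
      match (List.range (K + 1)).find?
        (fun i => decide (2 ^ j ≤ (bucket g τ w m L.toFinset W i).card)) with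
      | some i =>
        (layer τ w (τ * m * 2 ^ i) d (bucket g τ w m L.toFinset W i) L).bind (improve k)
      | none => .ret L

/-- Extends the solution `L` by elements of `W` until all buckets have less than `2 ^ j` elements,
and returns the new solution with the set of those elements of `W` whose density is still at
least `τ`. -/
noncomputable def rebuild (N : ℕ) (L : List (Fin n)) :
    OracleComp n (List (Fin n) × Finset (Fin n)) :=
  (improve τ w m K d j W N L).bind fun L' =>
    (ask (gainSets L'.toFinset W)).bind fun g => .ret (L', passSet g τ w 0 L'.toFinset W)

end

variable {τ : ℝ} {w : Fin n → ℝ} {m : ℝ} {K d j : ℕ} {W : Finset (Fin n)}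
  {f g : Finset (Fin n) → ℝ}

theorem bucket_congr {S : Finset (Fin n)} (h : ∀ A ∈ gainSets S W, g A = f A) :
    bucket g τ w m S W = bucket f τ w m S W := by
  funext i
  rw [bucket, bucket, passSet_congr h, passSet_congr h]

theorem bucket_subset (S : Finset (Fin n)) (i : ℕ) : bucket f τ w m S W i ⊆ W :=
  Finset.sdiff_subset.trans (Finset.filter_subset _ _)

theorem gain_lt_of_mem_bucket {S : Finset (Fin n)} {i : ℕ} {v : Fin n}
    (hv : v ∈ bucket f τ w m S W i) : gain f S v ≤ 2 * (τ * m * 2 ^ i) := by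
  rw [bucket, Finset.mem_sdiff, mem_passSet, mem_passSet] at hv
  by_contra h
  refine hv.2 ⟨hv.1.1, ?_, hv.1.2.2⟩
  rw [pow_succ]
  linarith

/-- The number of pairs of an element and a threshold that the element passes. -/
noncomputable def potential (f : Finset (Fin n) → ℝ) (τ : ℝ) (w : Fin n → ℝ) (m : ℝ) (K : ℕ)
    (S W : Finset (Fin n)) : ℕ :=
  ∑ i ∈ Finset.range (K + 1), (passSet f τ w (τ * m * 2 ^ i) S W).card

theorem potential_le (S : Finset (Fin n)) : potential f τ w m K S W ≤ (K + 1) * W.card := by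
  refine (Finset.sum_le_card_nsmul _ _ W.card fun i _ =>
    Finset.card_le_card (Finset.filter_subset _ _)).trans ?_
  simp

/-- At threshold `i` at least half of the bucket stops passing. At all other thresholds the passing
sets can only shrink. -/
theorem potential_decrease (hf : IsMonotoneSubmodular f) {S T : Finset (Fin n)} (hST : S ⊆ T)
    {i : ℕ} (hi : i ∈ Finset.range (K + 1))
    (h : 2 * (passSet f τ w (τ * m * 2 ^ i) T (bucket f τ w m S W i)).card ≤
      (bucket f τ w m S W i).card) :
    2 * potential f τ w m K T W + (bucket f τ w m S W i).card ≤ 2 * potential f τ w m K S W := by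
  have h1 : passSet f τ w (τ * m * 2 ^ i) T W ⊆
      (passSet f τ w (τ * m * 2 ^ i) S W \ bucket f τ w m S W i) ∪
        passSet f τ w (τ * m * 2 ^ i) T (bucket f τ w m S W i) := by
    intro v hv
    have hv' := passSet_anti hf hST hv
    by_cases hb : v ∈ bucket f τ w m S W i
    · exact Finset.mem_union_right _ (mem_passSet.2 ⟨hb, (mem_passSet.1 hv).2⟩)
    · exact Finset.mem_union_left _ (Finset.mem_sdiff.2 ⟨hv', hb⟩)
  have h2 := (Finset.card_le_card h1).trans (Finset.card_union_le _ _)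
  have h3 : bucket f τ w m S W i ⊆ passSet f τ w (τ * m * 2 ^ i) S W := Finset.sdiff_subset
  rw [Finset.card_sdiff_of_subset h3] at h2
  have h4 := Finset.card_le_card h3
  have h5 : ∑ k ∈ (Finset.range (K + 1)).erase i, (passSet f τ w (τ * m * 2 ^ k) T W).card ≤
      ∑ k ∈ (Finset.range (K + 1)).erase i, (passSet f τ w (τ * m * 2 ^ k) S W).card :=
    Finset.sum_le_sum fun k _ => Finset.card_le_card (passSet_anti hf hST)
  rw [potential, potential, ← Finset.add_sum_erase _ _ hi, ← Finset.add_sum_erase _ _ hi]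
  omega

/-- Every treated bucket has at least `2 ^ j` elements and lowers twice the potential by at least
that much. So either the rounds end early because no large bucket remains, or all `k` decreases have
taken place. -/
theorem ensures_improve (hf : IsMonotoneSubmodular f) (hτ : 0 < τ * m) (hd : W.card < 2 ^ d)
    (k : ℕ) {L : List (Fin n)} (hL : DenseChain f τ w L) :
    (improve τ w m K d j W k L).Ensures f (k * ((d + 3) * (W.card + 1))) fun L' =>
      L ⊆ L' ∧ (∀ x ∈ L', x ∈ L ∨ x ∈ W) ∧ DenseChain f τ w L' ∧
      ((∀ i ∈ Finset.range (K + 1), (bucket f τ w m L'.toFinset W i).card < 2 ^ j) ∨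
        2 * potential f τ w m K L'.toFinset W + k * 2 ^ j ≤
          2 * potential f τ w m K L.toFinset W) := by
  induction k generalizing L with
  | zero => exact ⟨List.Subset.refl _, fun x hx => Or.inl hx, hL, Or.inr (by simp)⟩
  | succ k ih =>
    rw [improve]
    refine (Ensures.ask_bind (N := (2 * W.card + d * (W.card + 1)) +
      k * ((d + 3) * (W.card + 1))) fun g hg => ?_).mono
      (by rw [length_gainSets]; nlinarith) fun _ => id
    rw [bucket_congr hg]
    split
    next i hi =>
      have hi1 := List.find?_some hi
      have hi2 := List.mem_of_find?_eq_some hi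
      rw [decide_eq_true_iff] at hi1
      rw [List.mem_range, ← Finset.mem_range] at hi2
      have hcard := Finset.card_le_card (bucket_subset (f := f) (τ := τ) (w := w) (m := m)
        (W := W) L.toFinset i)
      refine Ensures.bind ((ensures_layer hf (by positivity) (hcard.trans_lt hd) hL).mono
        (by gcongr) fun _ => id) fun L₁ h₁ => ?_
      obtain ⟨a1, a2, a3, a4⟩ := h₁
      refine (ih a3).mono le_rfl fun L' h' => ?_
      obtain ⟨b1, b2, b3, b4⟩ := h'
      refine ⟨List.Subset.trans a1 b1, fun x hx => ?_, b3, b4.imp id fun h => ?_⟩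
      · rcases b2 x hx with hx | hx
        · exact (a2 x hx).imp id fun h => bucket_subset _ _ h
        · exact Or.inr hx
      · have := potential_decrease hf (toFinset_subset a1) hi2 a4
        rw [add_mul, one_mul]
        omega
    next hi =>
      refine ⟨List.Subset.refl _, fun x hx => Or.inl hx, hL, Or.inl fun i hi' => ?_⟩
      rw [List.find?_eq_none] at hi
      simpa using hi i (by simpa using hi')

/-- Only buckets with at least `2 ^ j` elements are treated, so a bound on `D ∩ W` relative to `2 ^
j` bounds the fraction of `D` in each of them. -/
theorem le_E_improve (hf : IsMonotoneSubmodular f) (hτ : 0 < τ * m) (hd : W.card < 2 ^ d)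
    {D : Finset (Fin n)} {δ : ℝ} (hδ : 0 ≤ δ) (hD : 4 * ((D ∩ W).card : ℝ) ≤ δ * 2 ^ j) (k : ℕ)
    {L : List (Fin n)} (hL : DenseChain f τ w L) :
    chainSum f (fun x => δ - ind D x) L ≤
      (improve τ w m K d j W k L).E f fun L' => chainSum f (fun x => δ - ind D x) L' := by
  induction k generalizing L with
  | zero => exact le_rfl
  | succ k ih =>
    rw [improve]
    refine le_E_ask_bind fun g hg => ?_
    rw [bucket_congr hg]
    split
    next i hi =>
      have hi1 := List.find?_some hi
      rw [decide_eq_true_iff] at hi1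
      have hsub := bucket_subset (f := f) (τ := τ) (w := w) (m := m) (W := W) L.toFinset i
      have hcard := (Finset.card_le_card hsub).trans_lt hd
      have hpos : 0 < τ * m * 2 ^ i := by positivity
      rw [E_bind]
      refine (le_E_layer hf hpos hδ (hD := ?_) hcard hL
        fun v hv => gain_lt_of_mem_bucket hv).trans
        ((ensures_layer hf hpos hcard hL).E_mono fun L' h' => ih h'.2.2.1)
      have h1 : ((D ∩ bucket f τ w m L.toFinset W i).card : ℝ) ≤ (D ∩ W).card := by
        exact_mod_cast Finset.card_le_card (Finset.inter_subset_inter_left hsub)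
      have h2 : (2 ^ j : ℝ) ≤ (bucket f τ w m L.toFinset W i).card := by exact_mod_cast hi1
      have h3 := mul_le_mul_of_nonneg_left h2 hδ
      linarith
    next hi => exact le_rfl

theorem exists_pow_bucket {a x : ℝ} (h0 : a ≤ x) {k : ℕ} (h1 : x < a * 2 ^ k) :
    ∃ i < k, a * 2 ^ i ≤ x ∧ x < a * 2 ^ (i + 1) := by
  induction k with
  | zero => simp at h1; linarith
  | succ k ih =>
    by_cases h : x < a * 2 ^ k
    · obtain ⟨i, hi, h⟩ := ih h
      exact ⟨i, by omega, h⟩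
    · exact ⟨k, by omega, not_lt.1 h, h1⟩

/-- An element of density at least `τ` has marginal value at least `τ * m`, and its value is below
the upper end of the last bucket, so it lies in one of the `K + 1` buckets. -/
theorem card_passSet_zero_le (hf : IsMonotoneSubmodular f) (hτ : 0 < τ)
    (hW : ∀ v ∈ W, m ≤ w v ∧ gain f ∅ v < τ * m * 2 ^ (K + 1)) {S : Finset (Fin n)}
    (h : ∀ i ∈ Finset.range (K + 1), (bucket f τ w m S W i).card < 2 ^ j) :
    (passSet f τ w 0 S W).card ≤ (K + 1) * (2 ^ j - 1) := by
  have h1 : passSet f τ w 0 S W ⊆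
      (Finset.range (K + 1)).biUnion (bucket f τ w m S W) := by
    intro v hv
    rw [mem_passSet] at hv
    have h2 := hW v hv.1
    obtain ⟨i, hi, h3, h4⟩ := exists_pow_bucket (a := τ * m) (x := gain f S v) (k := K + 1)
      ((mul_le_mul_of_nonneg_left h2.1 hτ.le).trans hv.2.2)
      ((hf.gain_anti (Finset.empty_subset S) v).trans_lt h2.2)
    refine Finset.mem_biUnion.2 ⟨i, Finset.mem_range.2 hi, ?_⟩
    rw [bucket, Finset.mem_sdiff, mem_passSet, mem_passSet]
    exact ⟨⟨hv.1, h3, hv.2.2⟩, fun h => by linarith [h.2.1]⟩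
  refine ((Finset.card_le_card h1).trans Finset.card_biUnion_le).trans ?_
  refine (Finset.sum_le_card_nsmul _ _ (2 ^ j - 1) fun i hi => ?_).trans ?_
  · have := h i hi
    omega
  · simp

theorem ensures_rebuild (hf : IsMonotoneSubmodular f) (hτ : 0 < τ) (hm : 0 < m)
    (hd : W.card < 2 ^ d) {N : ℕ} (hN : 2 * ((K + 1) * W.card) < N * 2 ^ j)
    (hW : ∀ v ∈ W, m ≤ w v ∧ gain f ∅ v < τ * m * 2 ^ (K + 1))
    {L : List (Fin n)} (hL : DenseChain f τ w L) :
    (rebuild τ w m K d j W N L).Ensures f ((N * (d + 3) + 1) * (W.card + 1)) fun r =>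
      L ⊆ r.1 ∧ (∀ x ∈ r.1, x ∈ L ∨ x ∈ W) ∧ DenseChain f τ w r.1 ∧
      r.2.card ≤ (K + 1) * (2 ^ j - 1) ∧
      ∀ v ∈ W, v ∉ r.2 → gain f r.1.toFinset v < τ * w v := by
  refine ((ensures_improve hf (mul_pos hτ hm) hd N hL).bind (M := W.card + 1)
    fun L' h' => ?_).mono (by linarith) fun _ => id
  refine (Ensures.ask_bind (N := 0) fun g hg => ?_).mono (by rw [length_gainSets])
    fun _ => id
  rw [passSet_congr hg]
  obtain ⟨h1, h2, h3, h4⟩ := h'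
  refine ⟨h1, h2, h3, card_passSet_zero_le hf hτ hW ?_, fun v hv hv' => ?_⟩
  -- All `N` rounds cannot have been used: by `hN` the total decrease would exceed the initial
  -- potential.
  · refine h4.resolve_right fun h => ?_
    have := potential_le (f := f) (τ := τ) (w := w) (m := m) (K := K) (W := W) L.toFinset
    omega
  · rw [mem_passSet] at hv'
    by_contra hlt
    exact hv' ⟨hv, hf.gain_nonneg _ _, not_lt.1 hlt⟩

theorem le_E_rebuild (hf : IsMonotoneSubmodular f) (hτ : 0 < τ * m) (hd : W.card < 2 ^ d)
    {D : Finset (Fin n)} {δ : ℝ} (hδ : 0 ≤ δ) (hD : 4 * ((D ∩ W).card : ℝ) ≤ δ * 2 ^ j) (N : ℕ)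
    {L : List (Fin n)} (hL : DenseChain f τ w L) :
    chainSum f (fun x => δ - ind D x) L ≤
      (rebuild τ w m K d j W N L).E f fun r => chainSum f (fun x => δ - ind D x) r.1 := by
  refine (le_E_improve (K := K) hf hτ hd hδ hD N hL).trans ?_
  simp only [rebuild, E_bind, E, E_const, le_refl]

end OracleComp

/-! ### Histories of updates -/

/-- The elements that are inserted or deleted by a sequence of updates. -/
def touched {n : ℕ} (us : List (Update n)) : Finset (Fin n) := (us.map Update.elem).toFinset

section present

variable {n : ℕ}

theorem mem_touched {us : List (Update n)} {v : Fin n} :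
    v ∈ touched us ↔ ∃ u ∈ us, u.elem = v := by
  simp [touched]

theorem present_concat (us : List (Update n)) (u : Update n) :
    present (us ++ [u]) = u.apply (present us) := by
  simp [present]

theorem mem_present_append_iff {us us' : List (Update n)} {v : Fin n} (h : v ∉ touched us') :
    v ∈ present (us ++ us') ↔ v ∈ present us := by
  induction us' using List.reverseRecOn with
  | nil => simp
  | append_singleton us' u ih =>
    have h1 : v ∉ touched us' := fun h' => h (by
      rw [mem_touched] at h' ⊢
      obtain ⟨x, hx, e⟩ := h'
      exact ⟨x, by simp [hx], e⟩)
    have h2 : v ≠ u.elem := fun e => h (mem_touched.2 ⟨u, by simp, e.symm⟩)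
    rw [← List.append_assoc, present_concat, ← ih h1]
    cases u <;> simp_all [Update.apply, Update.elem]

theorem present_subset_touched (us : List (Update n)) : present us ⊆ touched us := by
  intro v hv
  by_contra h
  have := (mem_present_append_iff (us := []) h).1 (by simpa using hv)
  simp [present] at this

theorem card_touched_le (us : List (Update n)) : (touched us).card ≤ us.length :=
  (List.toFinset_card_le _).trans_eq (by simp)

theorem present_filter (p : Fin n → Prop) [DecidablePred p] (us : List (Update n)) :
    present (us.filter fun u => p u.elem) = (present us).filter p := by
  induction us using List.reverseRecOn with
  | nil => simp [present]
  | append_singleton us u ih =>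
    rw [List.filter_append, present_concat]
    by_cases h : p u.elem
    · rw [List.filter_singleton, decide_eq_true h, Bool.cond_true, present_concat, ih]
      cases u <;> ext v <;> simp only [Update.apply, Update.elem, Finset.mem_filter,
        Finset.mem_insert, Finset.mem_erase] at h ⊢ <;> grind
    · rw [List.filter_singleton, decide_eq_false h, Bool.cond_false, List.append_nil, ih]
      cases u <;> ext v <;> simp only [Update.apply, Update.elem, Finset.mem_filter,
        Finset.mem_insert, Finset.mem_erase] at h ⊢ <;> grind

end present

/-! ### The schedule of rebuilds -/

/-- The number of updates between two rebuilds of a level. -/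
def period (a j : ℕ) : ℕ := 2 ^ (j - a)

/-- The time of the last rebuild of level `j` up to time `t`. -/
def lastRebuild (a j t : ℕ) : ℕ := period a j * (t / period a j)

section period

variable {a j t : ℕ}

theorem period_pos (a j : ℕ) : 0 < period a j := Nat.two_pow_pos _

/-- Whenever a level is rebuilt, so are all lower ones; hence a level is always built on the current
solution of the level above it. -/
theorem period_dvd_succ (a j : ℕ) : period a j ∣ period a (j + 1) :=
  pow_dvd_pow 2 (by omega)

theorem period_le (a j : ℕ) : period a j ≤ 2 ^ j := Nat.pow_le_pow_right (by norm_num) (by omega)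

theorem two_pow_le_period_mul (a j : ℕ) : 2 ^ j ≤ period a j * 2 ^ a := by
  rw [period, ← pow_add]
  exact Nat.pow_le_pow_right (by norm_num) (by omega)

/-- For `j ≤ a` the truncated exponent gives period `1`, so `k = 0`: such levels are never out of
date. -/
theorem mul_two_pow_le_of_lt_period {k : ℕ} (h : k < period a j) : k * 2 ^ a ≤ 2 ^ j := by
  rcases le_total a j with haj | haj
  · calc k * 2 ^ a ≤ period a j * 2 ^ a := by gcongr
      _ = 2 ^ j := by rw [period, ← pow_add, Nat.sub_add_cancel haj]
  · rw [period, Nat.sub_eq_zero_of_le haj, pow_zero, Nat.lt_one_iff] at h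
    simp [h]

theorem lastRebuild_le (a j t : ℕ) : lastRebuild a j t ≤ t := Nat.mul_div_le _ _

theorem sub_lastRebuild_lt (a j t : ℕ) : t - lastRebuild a j t < period a j := by
  have h1 := Nat.div_add_mod t (period a j)
  have h2 := Nat.mod_lt t (period_pos a j)
  unfold lastRebuild
  omega

theorem lastRebuild_of_dvd (h : period a j ∣ t) : lastRebuild a j t = t := Nat.mul_div_cancel' h

theorem lastRebuild_succ_of_not_dvd (h : ¬ period a j ∣ t + 1) :
    lastRebuild a j (t + 1) = lastRebuild a j t := by
  rw [lastRebuild, lastRebuild, Nat.succ_div, if_neg h, add_zero]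

end period

/-! ### The hierarchy of levels for one density threshold -/

/-- The data stored for a level: the solution constructed so far, and the elements that have not
been discarded. -/
abbrev LevelData (n : ℕ) : Type := List (Fin n) × Finset (Fin n)

/-- The state of the algorithm for one density threshold: the relevant updates so far and the data
of all levels. -/
structure Scale (n : ℕ) : Type where
  hist : List (Update n)
  lev : ℕ → LevelData n

/-- The elements to be considered when level `j` is rebuilt. -/
def candidates {n : ℕ} (a j : ℕ) (hist : List (Update n)) (lev : ℕ → LevelData n) :
    Finset (Fin n) :=
  ((lev (j + 1)).2 ∪ touched (hist.drop (lastRebuild a (j + 1) hist.length))) ∩ present hist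

/-- A bound for the number of buckets treated in one rebuild. -/
def bucketRounds (K : ℕ) : ℕ := 2 * ((K + 1) * (2 * K + 4)) + 1

/-- A bound, up to a factor `2 ^ j`, for the number of queries made in a rebuild of level `j`. -/
def levelCost (K J : ℕ) : ℕ := (bucketRounds K * (J + 3) + 1) * (2 * K + 5)

/-- A bound for the number of queries made when the `t`-th relevant update is handled. -/
def scaleCost (K J a t : ℕ) : ℕ :=
  ∑ i ∈ Finset.range J, if period a i ∣ t then levelCost K J * 2 ^ i else 0

namespace OracleComp

variable {n : ℕ}

section

variable (τ : ℝ) (w : Fin n → ℝ) (m : ℝ) (K J a : ℕ)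

/-- Rebuilds, from the highest to the lowest, those levels below a given one for which it is
time. -/
noncomputable def rebuildLevels (hist : List (Update n)) :
    ℕ → (ℕ → LevelData n) → OracleComp n (ℕ → LevelData n)
  | 0, lev => .ret lev
  | j + 1, lev =>
    if period a j ∣ hist.length then
      (rebuild τ w m K J j (candidates a j hist lev) (bucketRounds K) (lev (j + 1)).1).bind
        fun r => rebuildLevels hist j (Function.update lev j r)
    else rebuildLevels hist j lev

/-- Handles one relevant update. -/
noncomputable def scaleStep (u : Update n) (I : Scale n) : OracleComp n (Scale n) :=
  (rebuildLevels τ w m K J a (I.hist ++ [u]) J I.lev).bind fun lev => .ret ⟨I.hist ++ [u], lev⟩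

end

/-- The invariant of the data of level `j`. -/
structure LevelInv (f : Finset (Fin n) → ℝ) (τ : ℝ) (w : Fin n → ℝ) (K a : ℕ)
    (hist : List (Update n)) (j : ℕ) (r : LevelData n) : Prop where
  gain_lt : ∀ v ∈ present (hist.take (lastRebuild a j hist.length)), v ∉ r.2 →
    gain f r.1.toFinset v < τ * w v
  card_le : r.2.card ≤ (K + 1) * (2 ^ j - 1)
  dense : DenseChain f τ w r.1
  touched : ∀ x ∈ r.1, x ∈ touched hist

/-- The updates concern only elements whose weight is correctly recorded and at least `m`, and
whose value is not too large. -/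
def Admissible (f : Finset (Fin n) → ℝ) (τ : ℝ) (w w' : Fin n → ℝ) (m : ℝ) (K : ℕ)
    (hist : List (Update n)) : Prop :=
  ∀ v ∈ _root_.touched hist, w' v = w v ∧ m ≤ w v ∧ gain f ∅ v < τ * m * 2 ^ (K + 1)

variable {f : Finset (Fin n) → ℝ} {τ : ℝ} {w w' : Fin n → ℝ} {m : ℝ} {K J a : ℕ}
  {hist : List (Update n)}

theorem LevelInv.concat {j : ℕ} {r : LevelData n} (h : LevelInv f τ w K a hist j r)
    (u : Update n) (hj : ¬ period a j ∣ (hist ++ [u]).length) :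
    LevelInv f τ w K a (hist ++ [u]) j r where
  gain_lt := by
    rw [List.length_append, List.length_singleton] at hj ⊢
    rw [lastRebuild_succ_of_not_dvd hj, List.take_append_of_le_length (lastRebuild_le _ _ _)]
    exact h.gain_lt
  card_le := h.card_le
  dense := h.dense
  touched x hx := by
    obtain ⟨y, hy, e⟩ := mem_touched.1 (h.touched x hx)
    exact mem_touched.2 ⟨y, by simp [hy], e⟩

theorem candidates_subset_touched (j : ℕ) (lev : ℕ → LevelData n) :
    candidates a j hist lev ⊆ touched hist :=
  Finset.inter_subset_right.trans (present_subset_touched hist)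

/-- At most `(K + 1) * 2 ^ (j + 1)` elements are left over from level `j + 1`, and at most `2 ^ (j +
1)` were touched since its last rebuild. -/
theorem card_candidates_le {j : ℕ} {lev : ℕ → LevelData n}
    (h : LevelInv f τ w K a hist (j + 1) (lev (j + 1))) :
    (candidates a j hist lev).card ≤ (2 * K + 4) * 2 ^ j := by
  have h1 : (candidates a j hist lev).card ≤ _ :=
    (Finset.card_le_card Finset.inter_subset_left).trans (Finset.card_union_le _ _)
  have h2 := card_touched_le (hist.drop (lastRebuild a (j + 1) hist.length))
  rw [List.length_drop] at h2
  have h3 := sub_lastRebuild_lt a (j + 1) hist.length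
  have h4 := period_le a (j + 1)
  have h5 : (K + 1) * (2 ^ (j + 1) - 1) ≤ (K + 1) * 2 ^ (j + 1) :=
    Nat.mul_le_mul_left _ (Nat.sub_le _ _)
  have h6 := h.card_le
  rw [pow_succ] at *
  nlinarith

theorem ensures_rebuild_level (hf : IsMonotoneSubmodular f) (hτ : 0 < τ) (hm : 0 < m)
    (hJ : n < 2 ^ J) {j : ℕ} {lev : ℕ → LevelData n}
    (h : LevelInv f τ w K a hist (j + 1) (lev (j + 1))) (hj : period a j ∣ hist.length)
    (hadm : Admissible f τ w w' m K hist) :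
    (rebuild τ w' m K J j (candidates a j hist lev) (bucketRounds K) (lev (j + 1)).1).Ensures f
      (levelCost K J * 2 ^ j) (LevelInv f τ w K a hist j) := by
  have hcard := card_candidates_le h
  have hpow : 0 < 2 ^ j := Nat.two_pow_pos j
  refine (ensures_rebuild hf hτ hm (((Finset.card_le_univ _).trans_eq (Fintype.card_fin n)).trans_lt
    hJ) (N := bucketRounds K) ?_ (fun v hv => ?_)
    (h.dense.congr fun x hx => ((hadm x (h.touched x hx)).1).symm)).mono ?_ fun r hr => ?_
  · have : 2 * ((K + 1) * (candidates a j hist lev).card) ≤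
        2 * ((K + 1) * ((2 * K + 4) * 2 ^ j)) := by gcongr
    rw [bucketRounds]
    nlinarith
  · have := hadm v (candidates_subset_touched j lev hv)
    rw [this.1]
    exact this.2
  · rw [levelCost, mul_assoc]
    gcongr
    nlinarith
  · obtain ⟨h1, h2, h3, h4, h5⟩ := hr
    have ht : ∀ x ∈ r.1, x ∈ touched hist := fun x hx =>
      (h2 x hx).elim (h.touched x) fun hx => candidates_subset_touched j lev hx
    refine ⟨fun v hv hv' => ?_, h4, h3.congr fun x hx => (hadm x (ht x hx)).1, ht⟩
    rw [lastRebuild_of_dvd hj, List.take_length] at hv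
    by_cases hc : v ∈ candidates a j hist lev
    · rw [← (hadm v (candidates_subset_touched j lev hc)).1]
      exact h5 v hc hv'
    -- A present element that is not a candidate was untouched since the last rebuild of level `j +
    -- 1`. It was therefore present then and discarded there, and its marginal value has only
    -- decreased.
    · rw [candidates, Finset.mem_inter, Finset.mem_union, not_and'] at hc
      have hc := not_or.1 (hc hv)
      refine (hf.gain_anti (toFinset_subset h1) v).trans_lt (h.gain_lt v ?_ hc.1)
      rw [← mem_present_append_iff hc.2, List.take_append_drop]
      exact hv

theorem ensures_rebuildLevels (hf : IsMonotoneSubmodular f) (hτ : 0 < τ) (hm : 0 < m)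
    (hJ : n < 2 ^ J) (hadm : Admissible f τ w w' m K hist) (k : ℕ) {lev : ℕ → LevelData n}
    (hk : LevelInv f τ w K a hist k (lev k))
    (hlev : ∀ i < k, ¬ period a i ∣ hist.length → LevelInv f τ w K a hist i (lev i)) :
    (rebuildLevels τ w' m K J a hist k lev).Ensures f
      (∑ i ∈ Finset.range k, if period a i ∣ hist.length then levelCost K J * 2 ^ i else 0)
      fun lev' => (∀ i, (k ≤ i ∨ ¬ period a i ∣ hist.length) → lev' i = lev i) ∧
        ∀ i < k, LevelInv f τ w K a hist i (lev' i) := by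
  induction k generalizing lev with
  | zero => exact ⟨fun _ _ => rfl, by simp⟩
  | succ j ih =>
    rw [rebuildLevels, Finset.sum_range_succ, add_comm (Finset.sum _ _)]
    split_ifs with hj
    · refine (ensures_rebuild_level hf hτ hm hJ hk hj hadm).bind fun r hr => ?_
      refine (ih (by simpa using hr) fun i hi hi' => ?_).mono le_rfl fun lev' h' => ⟨?_, ?_⟩
      · rw [Function.update_of_ne hi.ne]
        exact hlev i (by omega) hi'
      · intro i hi
        have hne : i ≠ j := by
          rintro rfl
          rcases hi with hi | hi
          · omega
          · exact hi hj
        rw [h'.1 i (hi.imp (by omega) id), Function.update_of_ne hne]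
      · intro i hi
        rcases Nat.lt_succ_iff_lt_or_eq.1 hi with hi | rfl
        · exact h'.2 i hi
        · rw [h'.1 i (Or.inl le_rfl), Function.update_self]
          exact hr
    · have hj' := hlev j (by omega) hj
      rw [zero_add]
      refine (ih hj' fun i hi => hlev i (by omega)).mono le_rfl fun lev' h' => ⟨?_, ?_⟩
      · exact fun i hi => h'.1 i (hi.imp (by omega) id)
      · intro i hi
        rcases Nat.lt_succ_iff_lt_or_eq.1 hi with hi | rfl
        · exact h'.2 i hi
        · rw [h'.1 i (Or.inl le_rfl)]
          exact hj'

/-- The estimate for one rebuild applies to any earlier state satisfying the invariant, because `D`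
is fixed in advance. It concerns the increment between two consecutive levels. -/
theorem E_rebuildLevels_nonneg (hf : IsMonotoneSubmodular f) (hτ : 0 < τ) (hm : 0 < m)
    (hJ : n < 2 ^ J) (hadm : Admissible f τ w w' m K hist) {D : Finset (Fin n)} {δ : ℝ}
    (hδ : 0 ≤ δ) {j : ℕ} (hD : 4 * ((D ∩ present hist).card : ℝ) ≤ δ * 2 ^ j)
    (hj : period a j ∣ hist.length) (k : ℕ) (hjk : j < k) {lev : ℕ → LevelData n}
    (hk : LevelInv f τ w K a hist k (lev k))
    (hlev : ∀ i < k, ¬ period a i ∣ hist.length → LevelInv f τ w K a hist i (lev i)) :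
    0 ≤ (rebuildLevels τ w' m K J a hist k lev).E f fun lev' =>
      chainSum f (fun x => δ - ind D x) (lev' j).1 -
        chainSum f (fun x => δ - ind D x) (lev' (j + 1)).1 := by
  induction k generalizing lev with
  | zero => omega
  | succ i ih =>
    rw [rebuildLevels]
    rcases Nat.lt_succ_iff_lt_or_eq.1 hjk with hji | rfl
    · split_ifs with hi
      · rw [E_bind]
        refine (ensures_rebuild_level hf hτ hm hJ hk hi hadm).le_E fun r hr => ?_
        refine ih hji (by simpa using hr) fun l hl hl' => ?_
        rw [Function.update_of_ne hl.ne]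
        exact hlev l (by omega) hl'
      · exact ih hji (hlev i (by omega) hi) fun l hl => hlev l (by omega)
    · rw [if_pos hj, E_bind]
      have hWJ : (candidates a j hist lev).card < 2 ^ J :=
        ((Finset.card_le_univ _).trans_eq (Fintype.card_fin n)).trans_lt hJ
      have hD' : 4 * ((D ∩ candidates a j hist lev).card : ℝ) ≤ δ * 2 ^ j := by
        refine le_trans ?_ hD
        gcongr
        exact Finset.inter_subset_right
      have main := le_E_rebuild (K := K) hf (mul_pos hτ hm) hWJ hδ hD' (bucketRounds K)
        (hk.dense.congr fun x hx => ((hadm x (hk.touched x hx)).1).symm)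
      -- Rebuilding the levels below `j` leaves levels `j` and `j + 1` as they are.
      have hr : ∀ r, LevelInv f τ w K a hist j r →
          ((rebuildLevels τ w' m K J a hist j (Function.update lev j r)).E f fun lev' =>
            chainSum f (fun x => δ - ind D x) (lev' j).1 -
              chainSum f (fun x => δ - ind D x) (lev' (j + 1)).1) =
          chainSum f (fun x => δ - ind D x) r.1 -
            chainSum f (fun x => δ - ind D x) (lev (j + 1)).1 := by
        intro r hr
        rw [← E_const (f := f) (rebuildLevels τ w' m K J a hist j (Function.update lev j r))
          (chainSum f (fun x => δ - ind D x) r.1 - _)]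
        refine (ensures_rebuildLevels hf hτ hm hJ hadm j (by simpa using hr)
          fun l hl hl' => ?_).E_congr fun lev' h' => ?_
        · rw [Function.update_of_ne hl.ne]
          exact hlev l (by omega) hl'
        · rw [h'.1 j (Or.inl le_rfl), h'.1 (j + 1) (Or.inl (by omega)), Function.update_self,
            Function.update_of_ne (by omega)]
      rw [(ensures_rebuild_level hf hτ hm hJ hk hj hadm).E_congr hr, E_sub, E_const]
      linarith

/-- The invariant of the state of the algorithm for one density threshold. -/
structure ScaleInv (f : Finset (Fin n) → ℝ) (τ : ℝ) (w : Fin n → ℝ) (K J a : ℕ)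
    (hist : List (Update n)) (I : Scale n) : Prop where
  hist_eq : I.hist = hist
  top : I.lev J = ([], Finset.univ)
  level : ∀ j < J, LevelInv f τ w K a hist j (I.lev j)

/-- Level `J` discards nothing, so it satisfies the invariant at all times and is never rebuilt. -/
theorem levelInv_top (hJ : n < 2 ^ J) (hist : List (Update n)) :
    LevelInv f τ w K a hist J ([], Finset.univ) where
  gain_lt v _ hv := absurd (Finset.mem_univ v) hv
  card_le := by
    rw [Finset.card_univ, Fintype.card_fin]
    calc n ≤ 2 ^ J - 1 := by omega
      _ ≤ (K + 1) * (2 ^ J - 1) := Nat.le_mul_of_pos_left _ (by omega)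
  dense := trivial
  touched := by simp

theorem ScaleInv.levelInv {I : Scale n} (hJ : n < 2 ^ J) (h : ScaleInv f τ w K J a hist I)
    (u : Update n) : LevelInv f τ w K a (hist ++ [u]) J (I.lev J) := by
  rw [h.top]
  exact levelInv_top hJ _

theorem ScaleInv.levelInv_concat {I : Scale n} (h : ScaleInv f τ w K J a hist I) (u : Update n) :
    ∀ i < J, ¬ period a i ∣ (hist ++ [u]).length →
      LevelInv f τ w K a (hist ++ [u]) i (I.lev i) :=
  fun i hi hi' => (h.level i hi).concat u hi'

theorem ensures_scaleStep (hf : IsMonotoneSubmodular f) (hτ : 0 < τ) (hm : 0 < m)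
    (hJ : n < 2 ^ J) {I : Scale n} (h : ScaleInv f τ w K J a hist I) (u : Update n)
    (hadm : Admissible f τ w w' m K (hist ++ [u])) :
    (scaleStep τ w' m K J a u I).Ensures f (scaleCost K J a (hist.length + 1)) fun I' =>
      ScaleInv f τ w K J a (hist ++ [u]) I' ∧
        ∀ i, (J ≤ i ∨ ¬ period a i ∣ hist.length + 1) → I'.lev i = I.lev i := by
  rw [scaleStep, h.hist_eq]
  refine ((ensures_rebuildLevels hf hτ hm hJ hadm J (h.levelInv hJ u)
    (h.levelInv_concat u)).bind (M := 0) (R := fun I' => ScaleInv f τ w K J a (hist ++ [u]) I' ∧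
        ∀ i, (J ≤ i ∨ ¬ period a i ∣ hist.length + 1) → I'.lev i = I.lev i) fun lev' h' => ?_).mono
    (by simp [scaleCost]) fun _ => id
  refine ⟨⟨rfl, ?_, h'.2⟩, fun i hi => h'.1 i (by simpa using hi)⟩
  rw [← h.top]
  exact h'.1 J (Or.inl le_rfl)

theorem E_scaleStep_nonneg (hf : IsMonotoneSubmodular f) (hτ : 0 < τ) (hm : 0 < m)
    (hJ : n < 2 ^ J) {I : Scale n} (h : ScaleInv f τ w K J a hist I) (u : Update n)
    (hadm : Admissible f τ w w' m K (hist ++ [u])) {D : Finset (Fin n)} {δ : ℝ}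
    (hδ : 0 ≤ δ) {j : ℕ} (hjJ : j < J)
    (hD : 4 * ((D ∩ present (hist ++ [u])).card : ℝ) ≤ δ * 2 ^ j)
    (hj : period a j ∣ hist.length + 1) :
    0 ≤ (scaleStep τ w' m K J a u I).E f fun I' =>
      chainSum f (fun x => δ - ind D x) (I'.lev j).1 -
        chainSum f (fun x => δ - ind D x) (I'.lev (j + 1)).1 := by
  rw [scaleStep, h.hist_eq, E_bind]
  exact E_rebuildLevels_nonneg hf hτ hm hJ hadm hδ hD (by simpa using hj) J hjJ (h.levelInv hJ u)
    (h.levelInv_concat u)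

/-- If level `j` is not rebuilt, then neither is level `j + 1`, the periods dividing each other. -/
theorem E_scaleStep_of_not_dvd (hf : IsMonotoneSubmodular f) (hτ : 0 < τ) (hm : 0 < m)
    (hJ : n < 2 ^ J) {I : Scale n} (h : ScaleInv f τ w K J a hist I) (u : Update n)
    (hadm : Admissible f τ w w' m K (hist ++ [u])) (c : Fin n → ℝ) {j : ℕ}
    (hj : ¬ period a j ∣ hist.length + 1) :
    ((scaleStep τ w' m K J a u I).E f fun I' =>
      chainSum f c (I'.lev j).1 - chainSum f c (I'.lev (j + 1)).1) =
      chainSum f c (I.lev j).1 - chainSum f c (I.lev (j + 1)).1 := by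
  rw [(ensures_scaleStep hf hτ hm hJ h u hadm).E_congr fun I' h' => ?_, E_const]
  rw [h'.2 j (Or.inr hj), h'.2 (j + 1) (Or.inr fun h => hj ((period_dvd_succ a j).trans h))]

end OracleComp

/-! ### Relevant density thresholds -/

/-- The scales `z`, standing for the density threshold `2 ^ z`, at which a marginal value `r` is
relevant, if `m` is the least weight. -/
noncomputable def scales (K : ℕ) (m r : ℝ) : Finset ℤ :=
  if 0 < r then Finset.Icc (Int.log 2 (r / m) - K) (Int.log 2 (r / m)) else ∅

section scales

variable {K : ℕ} {m r : ℝ} {z : ℤ}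

theorem card_scales_le (K : ℕ) (m r : ℝ) : (scales K m r).card ≤ K + 1 := by
  unfold scales
  split_ifs
  · rw [Int.card_Icc]; omega
  · simp

theorem lt_of_mem_scales (hm : 0 < m) (hz : z ∈ scales K m r) :
    r < (2 : ℝ) ^ z * m * 2 ^ (K + 1) := by
  unfold scales at hz
  split_ifs at hz with hr
  · rw [Finset.mem_Icc] at hz
    have h1 := Int.lt_zpow_succ_log_self (b := 2) (by norm_num) (r / m)
    rw [div_lt_iff₀ hm] at h1
    refine h1.trans_le ?_
    have h2 : (2 : ℝ) ^ (Int.log 2 (r / m) + 1) ≤ 2 ^ (z + (K + 1 : ℕ)) :=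
      zpow_le_zpow_right₀ (by norm_num) (by push_cast; omega)
    rw [zpow_add₀ two_ne_zero z, zpow_natCast] at h2
    push_cast
    calc (2 : ℝ) ^ (Int.log 2 (r / m) + 1) * m ≤ 2 ^ z * 2 ^ (K + 1) * m := by gcongr
      _ = 2 ^ z * m * 2 ^ (K + 1) := by ring
  · simp at hz

/-- The window of scales moves up with the value, so a scale in the window of `r'` can miss that of
a smaller `r` only by being too large. Elements ignored at a scale in use thus have density below
the threshold. -/
theorem lt_of_mem_of_notMem_scales {r' : ℝ} (hm : 0 < m) (hz : z ∈ scales K m r')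
    (hr : r ≤ r') (hz' : z ∉ scales K m r) : r < (2 : ℝ) ^ z * m := by
  unfold scales at hz hz'
  split_ifs at hz with h0
  · rw [Finset.mem_Icc] at hz
    split_ifs at hz' with h1
    · rw [Finset.mem_Icc, not_and_or] at hz'
      have h2 : Int.log 2 (r / m) ≤ Int.log 2 (r' / m) :=
        Int.log_mono_right (by positivity) (by gcongr)
      have h3 : Int.log 2 (r / m) < z := by omega
      rw [← Int.lt_zpow_iff_log_lt (by norm_num) (by positivity), div_lt_iff₀ hm] at h3
      exact_mod_cast h3
    · exact (not_lt.1 h1).trans_lt (by positivity)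
  · simp at hz

/-- The ideal threshold, with `O` the optimal cost, is among those maintained: `ε ≤ 1` and `m ≤ O`
give the upper end of the window, `hO'` the lower one. -/
theorem log_mem_scales {ε O : ℝ} (hm : 0 < m) (hε : 0 < ε) (hε1 : ε ≤ 1) (hr : 0 < r)
    (hO : m ≤ O) (hO' : O ≤ ε * m * 2 ^ K) : Int.log 2 (ε * r / O) ∈ scales K m r := by
  have hO0 : 0 < O := hm.trans_le hO
  rw [scales, if_pos hr, Finset.mem_Icc]
  constructor
  · rw [← Int.zpow_le_iff_le_log (by norm_num) (by positivity)]
    have h1 := Int.zpow_log_le_self (b := 2) (r := r / m) (by norm_num) (by positivity)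
    push_cast at h1 ⊢
    rw [zpow_sub₀ (by norm_num), zpow_natCast, div_le_div_iff₀ (by positivity) hO0]
    rw [le_div_iff₀ hm] at h1
    have h2 : (0 : ℝ) < 2 ^ Int.log 2 (r / m) := by positivity
    calc (2 : ℝ) ^ Int.log 2 (r / m) * O ≤ 2 ^ Int.log 2 (r / m) * (ε * m * 2 ^ K) := by gcongr
      _ = (2 ^ Int.log 2 (r / m) * m) * (ε * 2 ^ K) := by ring
      _ ≤ r * (ε * 2 ^ K) := by gcongr
      _ = ε * r * 2 ^ K := by ring
  · refine Int.log_mono_right (by positivity) ?_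
    rw [div_le_div_iff₀ hO0 hm]
    calc ε * r * m ≤ 1 * r * O := by gcongr
      _ = r * O := by ring

end scales

/-! ### Choosing among the thresholds -/

/-- The solution that is maintained, given the values `r₀` of the empty set and `r` of the set `V`
of present elements, the solutions `L` of all scales, and their values. -/
noncomputable def selectSolution {n : ℕ} (ε : ℝ) (K : ℕ) (m r₀ r : ℝ) (V : Finset (Fin n))
    (L : ℤ → List (Fin n)) (h : Finset (Fin n) → ℝ) : Finset (Fin n) :=
  if hZ : ((scales K m (r - r₀)).filter
      fun z => r - ε * (r - r₀) ≤ h (L z).toFinset).Nonempty then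
    (L (Finset.max' _ hZ)).toFinset ∩ V
  else ∅

section select

variable {n : ℕ} {f : Finset (Fin n) → ℝ} {w : Fin n → ℝ}

theorem cost_nonneg (hw : ∀ v, 0 < w v) (S : Finset (Fin n)) : 0 ≤ cost w S :=
  Finset.sum_nonneg fun v _ => (hw v).le

theorem exists_optCost_eq (w : Fin n → ℝ) (f : Finset (Fin n) → ℝ) (V : Finset (Fin n)) :
    ∃ S, f S = f V ∧ S ⊆ V ∧ optCost w f V = cost w S := by
  classical
  obtain ⟨S, hS, h⟩ := Finset.exists_mem_eq_inf' (s := V.powerset.filter fun S => f S = f V)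
    ⟨V, by simp⟩ (cost w)
  rw [Finset.mem_filter, Finset.mem_powerset] at hS
  refine ⟨S, hS.2, hS.1, ?_⟩
  rw [← h, optCost]

/-- The ideal scale passes the value test, so the chosen scale `y` is at least as large, and a
larger density means a smaller cost. The value test is made before deleted elements are removed; the
sum in the conclusion accounts for their removal. -/
theorem selectSolution_spec (hf : IsMonotoneSubmodular f) {m ε : ℝ} {K : ℕ} (hm : 0 < m)
    (hw : ∀ v, m ≤ w v) (hε : 0 < ε) (hε1 : ε ≤ 1)
    (hK : cost w Finset.univ ≤ ε * m * 2 ^ K) {V : Finset (Fin n)} {L : ℤ → List (Fin n)}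
    {h : Finset (Fin n) → ℝ}
    (hh : ∀ z ∈ scales K m (f V - f ∅), h (L z).toFinset = f (L z).toFinset)
    (hdense : ∀ z ∈ scales K m (f V - f ∅), DenseChain f ((2 : ℝ) ^ z) w (L z))
    (hgain : ∀ z ∈ scales K m (f V - f ∅), ∀ v ∈ V,
      gain f (L z).toFinset v ≤ (2 : ℝ) ^ z * w v) :
    selectSolution ε K m (f ∅) (f V) V L h ⊆ V ∧
    cost w (selectSolution ε K m (f ∅) (f V) V L h) ≤ 2 / ε * optCost w f V ∧
    f V - ε * (f V - f ∅) -
      ∑ z ∈ scales K m (f V - f ∅), chainSum f (ind Vᶜ) (L z) ≤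
      f (selectSolution ε K m (f ∅) (f V) V L h) := by
  have hw0 : ∀ v, 0 < w v := fun v => hm.trans_le (hw v)
  obtain ⟨S, hSV, hS, hopt⟩ := exists_optCost_eq w f V
  have hF : 0 ≤ f V - f ∅ := sub_nonneg.2 (hf.mono _ _ (Finset.empty_subset _))
  rcases hF.eq_or_lt with hF | hF
  · have hs : scales K m (f V - f ∅) = ∅ := by simp [scales, ← hF]
    have hsel : selectSolution ε K m (f ∅) (f V) V L h = ∅ := by simp [selectSolution, hs]
    rw [hsel, hs, hopt, ← hF]
    refine ⟨Finset.empty_subset _, ?_, ?_⟩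
    · have := cost_nonneg hw0 S
      rw [cost, Finset.sum_empty]
      positivity
    · simp only [Finset.sum_empty]
      linarith
  have hSne : S.Nonempty := by
    rw [Finset.nonempty_iff_ne_empty]
    rintro rfl
    rw [hSV] at hF
    linarith
  obtain ⟨v₀, hv₀⟩ := hSne
  have hO : m ≤ cost w S :=
    (hw v₀).trans (Finset.single_le_sum (f := w) (fun v _ => (hw0 v).le) hv₀)
  have hO' : cost w S ≤ ε * m * 2 ^ K := le_trans
    (Finset.sum_le_sum_of_subset_of_nonneg (Finset.subset_univ S) fun v _ _ => (hw0 v).le) hK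
  have hO0 : 0 < cost w S := hm.trans_le hO
  have hz := log_mem_scales hm hε hε1 hF hO hO'
  set z := Int.log 2 (ε * (f V - f ∅) / cost w S) with hzdef
  have hz1 : (2 : ℝ) ^ z * cost w S ≤ ε * (f V - f ∅) := by
    have := Int.zpow_log_le_self (b := 2) (r := ε * (f V - f ∅) / cost w S) (by norm_num)
      (by positivity)
    rw [← hzdef, le_div_iff₀ hO0] at this
    exact_mod_cast this
  have hz2 : ε * (f V - f ∅) < 2 ^ z * 2 * cost w S := by
    have := Int.lt_zpow_succ_log_self (b := 2) (by norm_num) (ε * (f V - f ∅) / cost w S)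
    rw [← hzdef, div_lt_iff₀ hO0, zpow_add_one₀ (by norm_num)] at this
    exact_mod_cast this
  have hzZ : z ∈ (scales K m (f V - f ∅)).filter
      fun z => f V - ε * (f V - f ∅) ≤ h (L z).toFinset := by
    refine Finset.mem_filter.2 ⟨hz, ?_⟩
    rw [hh z hz]
    -- Adding the optimal cover `S` to the solution would gain at most `2 ^ z * cost w S ≤ ε * (f V
    -- - f ∅)`.
    have h1 := hf.le_add_sum_gain (L z).toFinset S
    have h2 : ∑ v ∈ S, gain f (L z).toFinset v ≤ 2 ^ z * cost w S := by
      rw [cost, Finset.mul_sum]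
      exact Finset.sum_le_sum fun v hv => hgain z hz v (hS hv)
    linarith
  rw [selectSolution, dif_pos ⟨z, hzZ⟩]
  set y := Finset.max' _ (⟨z, hzZ⟩ : Finset.Nonempty _) with hy
  have hyZ := Finset.max'_mem _ (⟨z, hzZ⟩ : Finset.Nonempty _)
  rw [← hy, Finset.mem_filter] at hyZ
  have hzy : z ≤ y := Finset.le_max' _ _ hzZ
  refine ⟨Finset.inter_subset_right, ?_, ?_⟩
  · have h1 := (hdense y hyZ.1).cost_le (by positivity) hw0 V
    have h2 := chainSum_ind_le hf V (L y)
    have h3 := hf.mono ((L y).toFinset ∩ V) V Finset.inter_subset_right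
    have h4 : (2 : ℝ) ^ z ≤ 2 ^ y := zpow_le_zpow_right₀ (by norm_num) hzy
    have h5 := mul_le_mul_of_nonneg_right h4 (cost_nonneg hw0 ((L y).toFinset ∩ V))
    have h6 : (0 : ℝ) < 2 ^ z := by positivity
    rw [hopt, div_mul_eq_mul_div, le_div_iff₀ hε]
    refine le_of_mul_le_mul_left ?_ h6
    nlinarith
  · have h1 := le_inter_add_chainSum hf V (L y)
    -- Since `y` depends on the random choices, its loss is bounded by the sum over all scales,
    -- whose expectation can be taken term by term.
    have h2 := Finset.single_le_sum
      (f := fun z => chainSum f (ind Vᶜ) (L z))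
      (fun z _ => chainSum_nonneg hf (ind_nonneg _) (L z)) hyZ.1
    have h3 := hyZ.2
    rw [hh y hyZ.1] at h3
    linarith

end select

/-! ### The whole algorithm -/

/-- The state of the whole algorithm. -/
structure CoverState (n : ℕ) : Type where
  hist : List (Update n)
  weight : Fin n → ℝ
  scale : ℤ → Scale n
  out : Finset (Fin n)

/-- The initial state for one density threshold. -/
def Scale.start (n J : ℕ) : Scale n := ⟨[], fun j => if j < J then ([], ∅) else ([], Finset.univ)⟩

/-- The updates that are relevant at the scale `z`. -/
noncomputable def relevant {n : ℕ} (f : Finset (Fin n) → ℝ) (K : ℕ) (m : ℝ) (z : ℤ)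
    (us : List (Update n)) : List (Update n) :=
  us.filter fun u => z ∈ scales K m (gain f ∅ u.elem)

namespace OracleComp

variable {n : ℕ}

/-- Handles one update. -/
noncomputable def coverStep (ε m : ℝ) (K J a : ℕ) (s : CoverState n) (u : Update n) (r : ℝ) :
    OracleComp n (CoverState n) :=
  (ask [∅, insert u.elem ∅, present (s.hist ++ [u])]).bind fun g =>
    (forEach (fun z I => scaleStep ((2 : ℝ) ^ z) (Function.update s.weight u.elem r) m K J a u I)
      (scales K m (gain g ∅ u.elem)).toList s.scale).bind fun sc =>
    (ask ((scales K m (g (present (s.hist ++ [u])) - g ∅)).toList.map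
      fun z => ((sc z).lev 0).1.toFinset)).bind fun h =>
    .ret ⟨s.hist ++ [u], Function.update s.weight u.elem r, sc,
      selectSolution ε K m (g ∅) (g (present (s.hist ++ [u]))) (present (s.hist ++ [u]))
        (fun z => ((sc z).lev 0).1) h⟩

/-- The invariant of the state of the whole algorithm. -/
structure CoverInv (f : Finset (Fin n) → ℝ) (w : Fin n → ℝ) (ε m : ℝ) (K J a : ℕ)
    (us : List (Update n)) (s : CoverState n) : Prop where
  hist_eq : s.hist = us
  weight_eq : ∀ u ∈ us, s.weight u.elem = w u.elem
  scale : ∀ z : ℤ, ScaleInv f ((2 : ℝ) ^ z) w K J a (relevant f K m z us) (s.scale z)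
  out_subset : s.out ⊆ present us
  cost_le : cost w s.out ≤ 2 / ε * optCost w f (present us)
  le_value : f (present us) - ε * (f (present us) - f ∅) -
    ∑ z ∈ scales K m (f (present us) - f ∅),
      chainSum f (ind (present us)ᶜ) ((s.scale z).lev 0).1 ≤ f s.out

variable {f : Finset (Fin n) → ℝ} {w : Fin n → ℝ} {ε m : ℝ} {K J a : ℕ}

theorem relevant_concat_of_mem {z : ℤ} {u : Update n} (us : List (Update n))
    (hz : z ∈ scales K m (gain f ∅ u.elem)) :
    relevant f K m z (us ++ [u]) = relevant f K m z us ++ [u] := by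
  simp [relevant, hz]

theorem relevant_concat_of_notMem {z : ℤ} {u : Update n} (us : List (Update n))
    (hz : z ∉ scales K m (gain f ∅ u.elem)) :
    relevant f K m z (us ++ [u]) = relevant f K m z us := by
  simp [relevant, hz]

theorem present_relevant (z : ℤ) (us : List (Update n)) :
    present (relevant f K m z us) =
      (present us).filter fun v => z ∈ scales K m (gain f ∅ v) :=
  present_filter (fun v => z ∈ scales K m (gain f ∅ v)) us

theorem admissible_relevant (hm : 0 < m) (hw : ∀ v, m ≤ w v) {w' : Fin n → ℝ} {z : ℤ}
    {us : List (Update n)} (h : ∀ u ∈ us, w' u.elem = w u.elem) :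
    Admissible f ((2 : ℝ) ^ z) w w' m K (relevant f K m z us) := by
  intro v hv
  obtain ⟨u, hu, rfl⟩ := mem_touched.1 hv
  rw [relevant, List.mem_filter, decide_eq_true_iff] at hu
  exact ⟨h u hu.1, hw _, lt_of_mem_scales hm hu.2⟩

theorem ScaleInv.dense {τ : ℝ} {hist : List (Update n)} {I : Scale n} (hJ : 0 < J)
    (h : ScaleInv f τ w K J a hist I) : DenseChain f τ w (I.lev 0).1 :=
  (h.level 0 hJ).dense

theorem ScaleInv.gain_lt {τ : ℝ} {hist : List (Update n)} {I : Scale n} (hJ : 0 < J)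
    (h : ScaleInv f τ w K J a hist I) {v : Fin n} (hv : v ∈ present hist) :
    gain f (I.lev 0).1.toFinset v < τ * w v := by
  have h0 := h.level 0 hJ
  refine h0.gain_lt v ?_ ?_
  · rwa [lastRebuild_of_dvd (by simp [period]), List.take_length]
  -- At level `0` the bound `(K + 1) * (2 ^ 0 - 1)` is zero: nothing is left undecided.
  · have := h0.card_le
    rw [pow_zero, Nat.sub_self, mul_zero, Nat.le_zero, Finset.card_eq_zero] at this
    simp [this]

/-- Elements relevant at `z` are handled by level `0`, which is rebuilt at every relevant update.
The others have density below the threshold even with respect to the empty set. -/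
theorem gain_le_of_mem_scales (hf : IsMonotoneSubmodular f) (hm : 0 < m) (hw : ∀ v, m ≤ w v)
    (hJ : 0 < J) {us : List (Update n)} {z : ℤ} {I : Scale n}
    (h : ScaleInv f ((2 : ℝ) ^ z) w K J a (relevant f K m z us) I)
    (hz : z ∈ scales K m (f (present us) - f ∅)) {v : Fin n} (hv : v ∈ present us) :
    gain f (I.lev 0).1.toFinset v ≤ (2 : ℝ) ^ z * w v := by
  by_cases hzv : z ∈ scales K m (gain f ∅ v)
  · refine (h.gain_lt hJ ?_).le
    rw [present_relevant, Finset.mem_filter]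
    exact ⟨hv, hzv⟩
  · refine (hf.gain_anti (Finset.empty_subset _) v).trans ?_
    have h1 : gain f ∅ v ≤ f (present us) - f ∅ := by
      have := hf.mono (insert v ∅) (present us) (by simpa using hv)
      rw [gain]
      linarith
    refine (lt_of_mem_of_notMem_scales hm hz h1 hzv).le.trans ?_
    have := hw v
    gcongr

theorem ensures_coverStep (hf : IsMonotoneSubmodular f) (hm : 0 < m) (hw : ∀ v, m ≤ w v)
    (hε : 0 < ε) (hε1 : ε ≤ 1) (hK : cost w Finset.univ ≤ ε * m * 2 ^ K) (hJ : n < 2 ^ J)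
    (hJ0 : 0 < J) {us : List (Update n)} {s : CoverState n} (hs : CoverInv f w ε m K J a us s)
    (u : Update n) :
    (coverStep ε m K J a s u (w u.elem)).Ensures f
      (K + 4 + ∑ z ∈ scales K m (gain f ∅ u.elem),
        scaleCost K J a ((relevant f K m z us).length + 1))
      (CoverInv f w ε m K J a (us ++ [u])) := by
  rw [coverStep, hs.hist_eq]
  set w' := Function.update s.weight u.elem (w u.elem) with hw'
  have hweight : ∀ x ∈ us ++ [u], w' x.elem = w x.elem := by
    intro x hx
    by_cases hxu : x.elem = u.elem
    · rw [hw', hxu, Function.update_self]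
    · rw [hw', Function.update_of_ne hxu]
      rcases List.mem_append.1 hx with hx | hx
      · exact hs.weight_eq x hx
      · rw [List.mem_singleton] at hx
        exact absurd (by rw [hx]) hxu
  -- Of the `K + 4` extra queries, three precede the scale steps and at most `K + 1` evaluate the
  -- solutions of the scales afterwards.
  refine (Ensures.ask_bind (N := ∑ z ∈ scales K m (gain f ∅ u.elem),
    scaleCost K J a ((relevant f K m z us).length + 1) + (K + 1)) fun g hg => ?_).mono
    (by simp only [List.length_cons, List.length_nil]; omega) fun _ => id
  have hg0 : g ∅ = f ∅ := hg _ (by simp)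
  have hgain : gain g ∅ u.elem = gain f ∅ u.elem := by
    rw [gain, gain, hg0, hg _ (by simp)]
  rw [hgain, hg0, hg (present (us ++ [u])) (by simp), ← Finset.sum_map_toList]
  refine (ensures_forEach (Finset.nodup_toList _)
    (N := fun z => scaleCost K J a ((relevant f K m z us).length + 1))
    (Q := fun z I => ScaleInv f ((2 : ℝ) ^ z) w K J a (relevant f K m z (us ++ [u])) I)
    fun z hz => ?_).bind fun sc hsc => ?_
  · rw [Finset.mem_toList] at hz
    rw [relevant_concat_of_mem us hz]
    refine (ensures_scaleStep hf (by positivity) hm hJ (hs.scale z) u ?_).mono le_rfl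
      fun _ h => h.1
    rw [← relevant_concat_of_mem us hz]
    exact admissible_relevant hm hw hweight
  have hscale : ∀ z : ℤ,
      ScaleInv f ((2 : ℝ) ^ z) w K J a (relevant f K m z (us ++ [u])) (sc z) := by
    intro z
    by_cases hz : z ∈ scales K m (gain f ∅ u.elem)
    · exact hsc.1 z (Finset.mem_toList.2 hz)
    · rw [hsc.2 z (by rwa [Finset.mem_toList]), relevant_concat_of_notMem us hz]
      exact hs.scale z
  refine (Ensures.ask_bind (N := 0) fun h hh => ?_).mono
    (by simpa using card_scales_le K m _) fun _ => id
  have sel := selectSolution_spec hf hm hw hε hε1 hK (V := present (us ++ [u]))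
    (L := fun z => ((sc z).lev 0).1) (h := h)
    (fun z hz => hh _ (List.mem_map.2 ⟨z, Finset.mem_toList.2 hz, rfl⟩))
    (fun z _ => (hscale z).dense hJ0)
    (fun z hz v hv => gain_le_of_mem_scales hf hm hw hJ0 (hscale z) hz hv)
  exact ⟨rfl, hweight, hscale, sel.1, sel.2.1, sel.2.2⟩

theorem le_E_coverStep {s : CoverState n} {u : Update n} {r r' : ℝ} {z : ℤ} {X : Scale n → ℝ}
    (h1 : z ∈ scales K m (gain f ∅ u.elem) → r ≤ (scaleStep ((2 : ℝ) ^ z)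
      (Function.update s.weight u.elem r') m K J a u (s.scale z)).E f X)
    (h2 : z ∉ scales K m (gain f ∅ u.elem) → r ≤ X (s.scale z)) :
    r ≤ (coverStep ε m K J a s u r').E f fun s' => X (s'.scale z) := by
  refine le_E_ask_bind fun g hg => ?_
  have hgain : gain g ∅ u.elem = gain f ∅ u.elem := by
    rw [gain, gain, hg _ (by simp), hg _ (by simp)]
  simp only [hgain, E_bind, E, E_const]
  by_cases hz : z ∈ scales K m (gain f ∅ u.elem)
  · rw [E_forEach_of_mem (Finset.nodup_toList _) (Finset.mem_toList.2 hz)]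
    exact h1 hz
  · rw [E_forEach_of_notMem (by rwa [Finset.mem_toList])]
    exact h2 hz

end OracleComp

/-! ### Amortized number of queries -/

open OracleComp

/-- The algorithm with least weight `m`, `K + 1` buckets, `J` levels and rebuilding parameter
`a`. -/
noncomputable def coverAlgorithm (n : ℕ) (ε m : ℝ) (K J a : ℕ) : DynamicAlgorithm n where
  State := CoverState n
  start := ⟨[], 0, fun _ => Scale.start n J, ∅⟩
  step := coverStep ε m K J a
  solution := CoverState.out

/-- A bound for the number of queries made by the algorithm, if `T` contains all relevant
scales. -/
noncomputable def queryBound {n : ℕ} (f : Finset (Fin n) → ℝ) (m : ℝ) (K J a : ℕ) (T : Finset ℤ)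
    (us : List (Update n)) : ℕ :=
  (K + 4) * us.length +
    ∑ z ∈ T, ∑ t ∈ Finset.range (relevant f K m z us).length, scaleCost K J a (t + 1)

/-- Level `i` is rebuilt `N / period a i` times at a cost proportional to `2 ^ i ≤ period a i * 2 ^
a`, so each level costs a multiple of `2 ^ a` per relevant update. -/
theorem sum_scaleCost_le (K J a N : ℕ) :
    ∑ t ∈ Finset.range N, scaleCost K J a (t + 1) ≤ J * (levelCost K J * 2 ^ a) * N := by
  have h : ∑ t ∈ Finset.range N, scaleCost K J a (t + 1) =
      ∑ i ∈ Finset.range J, levelCost K J * 2 ^ i * (N / period a i) := by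
    induction N with
    | zero => simp
    | succ N ih =>
      rw [Finset.sum_range_succ, ih, scaleCost, ← Finset.sum_add_distrib]
      refine Finset.sum_congr rfl fun i _ => ?_
      rw [Nat.succ_div]
      split_ifs <;> ring
  rw [h]
  refine (Finset.sum_le_card_nsmul _ _ (levelCost K J * 2 ^ a * N) fun i _ => ?_).trans_eq
    (by simp [mul_assoc])
  calc levelCost K J * 2 ^ i * (N / period a i)
      ≤ levelCost K J * (period a i * 2 ^ a) * (N / period a i) := by
        gcongr
        exact two_pow_le_period_mul a i
    _ = levelCost K J * 2 ^ a * (period a i * (N / period a i)) := by ring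
    _ ≤ levelCost K J * 2 ^ a * N := by
        gcongr
        exact Nat.mul_div_le _ _

section

variable {n : ℕ} {f : Finset (Fin n) → ℝ} {w : Fin n → ℝ} {ε m : ℝ} {K J a : ℕ}

theorem sum_length_relevant_le (T : Finset ℤ) (us : List (Update n)) :
    ∑ z ∈ T, (relevant f K m z us).length ≤ (K + 1) * us.length := by
  induction us using List.reverseRecOn with
  | nil => simp [relevant]
  | append_singleton us u ih =>
    have h : ∀ z ∈ T, (relevant f K m z (us ++ [u])).length =
        (relevant f K m z us).length + if z ∈ scales K m (gain f ∅ u.elem) then 1 else 0 := by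
      intro z _
      split_ifs with hz
      · simp [relevant_concat_of_mem us hz]
      · simp [relevant_concat_of_notMem us hz]
    rw [Finset.sum_congr rfl h, Finset.sum_add_distrib, Finset.sum_ite_mem, Finset.sum_const,
      smul_eq_mul, mul_one, List.length_append, List.length_singleton, mul_add, mul_one]
    exact Nat.add_le_add ih ((Finset.card_le_card Finset.inter_subset_right).trans
      (card_scales_le K m _))

theorem queryBound_le (T : Finset ℤ) (us : List (Update n)) :
    queryBound f m K J a T us ≤
      us.length * (K + 4 + (K + 1) * (J * (levelCost K J * 2 ^ a))) := by
  have h1 : ∑ z ∈ T, ∑ t ∈ Finset.range (relevant f K m z us).length, scaleCost K J a (t + 1) ≤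
      J * (levelCost K J * 2 ^ a) * ∑ z ∈ T, (relevant f K m z us).length := by
    rw [Finset.mul_sum]
    exact Finset.sum_le_sum fun z _ => sum_scaleCost_le K J a _
  have h2 := Nat.mul_le_mul_left (J * (levelCost K J * 2 ^ a))
    (sum_length_relevant_le (f := f) (K := K) (m := m) T us)
  rw [queryBound]
  calc _ ≤ (K + 4) * us.length + J * (levelCost K J * 2 ^ a) * ((K + 1) * us.length) := by
        gcongr
        exact h1.trans h2
    _ = _ := by ring

theorem queryBound_concat {T : Finset ℤ} {u : Update n}
    (hT : scales K m (gain f ∅ u.elem) ⊆ T) (us : List (Update n)) :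
    queryBound f m K J a T (us ++ [u]) = queryBound f m K J a T us +
      (K + 4 + ∑ z ∈ scales K m (gain f ∅ u.elem),
        scaleCost K J a ((relevant f K m z us).length + 1)) := by
  have h : ∀ z ∈ T,
      ∑ t ∈ Finset.range (relevant f K m z (us ++ [u])).length, scaleCost K J a (t + 1) =
      ∑ t ∈ Finset.range (relevant f K m z us).length, scaleCost K J a (t + 1) +
        if z ∈ scales K m (gain f ∅ u.elem) then
          scaleCost K J a ((relevant f K m z us).length + 1) else 0 := by
    intro z _
    split_ifs with hz
    · rw [relevant_concat_of_mem us hz, List.length_append, List.length_singleton,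
        Finset.sum_range_succ]
    · rw [relevant_concat_of_notMem us hz, add_zero]
  rw [queryBound, queryBound, Finset.sum_congr rfl h, Finset.sum_add_distrib,
    Finset.sum_ite_mem, Finset.inter_eq_right.2 hT, List.length_append, List.length_singleton]
  ring

theorem scaleInv_start (τ : ℝ) (w : Fin n → ℝ) :
    ScaleInv f τ w K J a [] (Scale.start n J) where
  hist_eq := rfl
  top := by simp [Scale.start]
  level j hj := by
    simp only [Scale.start, hj, if_true]
    exact ⟨by simp [present], by simp, trivial, by simp⟩

theorem coverInv_start (hw : ∀ v, 0 < w v) (hε : 0 < ε) :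
    CoverInv f w ε m K J a [] (coverAlgorithm n ε m K J a).start where
  hist_eq := rfl
  weight_eq := by simp
  scale z := scaleInv_start _ w
  out_subset := Finset.empty_subset _
  cost_le := by
    obtain ⟨S, -, -, h⟩ := exists_optCost_eq w f (present [])
    rw [h]
    have := cost_nonneg hw S
    simp only [coverAlgorithm, cost, Finset.sum_empty] at this ⊢
    positivity
  le_value := by simp [present, coverAlgorithm, scales]

/-! ### Expected loss caused by deletions -/

/-- The standing assumptions on the parameters of the algorithm. -/
structure Setting (f : Finset (Fin n) → ℝ) (w : Fin n → ℝ) (ε m : ℝ) (K J a : ℕ) : Prop where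
  submodular : IsMonotoneSubmodular f
  m_pos : 0 < m
  m_le : ∀ v, m ≤ w v
  ε_pos : 0 < ε
  ε_le : ε ≤ 1
  cost_le : cost w Finset.univ ≤ ε * m * 2 ^ K
  lt_pow : n < 2 ^ J
  J_pos : 0 < J
  le_pow : 8 * (K + 1) ≤ ε * 2 ^ a

namespace Setting

theorem ensures_comp (h : Setting f w ε m K J a) (us : List (Update n)) :
    ((coverAlgorithm n ε m K J a).comp w us).Ensures f
      (queryBound f m K J a (Finset.univ.biUnion fun v => scales K m (gain f ∅ v)) us)
      (CoverInv f w ε m K J a us) := by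
  induction us using List.reverseRecOn with
  | nil => exact coverInv_start (fun v => h.m_pos.trans_le (h.m_le v)) h.ε_pos
  | append_singleton us u ih =>
    rw [DynamicAlgorithm.comp_concat, queryBound_concat
      (Finset.subset_biUnion_of_mem (fun v => scales K m (gain f ∅ v)) (Finset.mem_univ u.elem))]
    exact ih.bind fun s hs => ensures_coverStep h.submodular h.m_pos h.m_le h.ε_pos h.ε_le
      h.cost_le h.lt_pow h.J_pos hs u

/-- The increment from level `j + 1` to level `j` is determined at the last rebuild of level `j`. It
therefore suffices that few elements present at that moment lie in `D`, which is fixed throughout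
the induction on the updates. -/
theorem E_level_nonneg (h : Setting f w ε m K J a) {D : Finset (Fin n)} {δ : ℝ} (hδ : 0 ≤ δ)
    (z : ℤ) {j : ℕ} (hj : j < J) (us : List (Update n))
    (hD : 4 * ((D ∩ present ((relevant f K m z us).take
      (lastRebuild a j (relevant f K m z us).length))).card : ℝ) ≤ δ * 2 ^ j) :
    0 ≤ ((coverAlgorithm n ε m K J a).comp w us).E f fun s =>
      chainSum f (fun x => δ - ind D x) ((s.scale z).lev j).1 -
        chainSum f (fun x => δ - ind D x) ((s.scale z).lev (j + 1)).1 := by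
  induction us using List.reverseRecOn with
  | nil =>
    simp only [DynamicAlgorithm.comp, List.foldl_nil, E, coverAlgorithm, Scale.start]
    split_ifs <;> simp [chainSum]
  | append_singleton us u ih =>
    rw [DynamicAlgorithm.comp_concat, E_bind]
    have hstep : ∀ (s : CoverState n) (r : ℝ), CoverInv f w ε m K J a us s →
        (z ∈ scales K m (gain f ∅ u.elem) → period a j ∣ (relevant f K m z us).length + 1 →
          r ≤ 0) →
        (¬ (z ∈ scales K m (gain f ∅ u.elem) ∧ period a j ∣ (relevant f K m z us).length + 1) →
          r ≤ chainSum f (fun x => δ - ind D x) ((s.scale z).lev j).1 -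
            chainSum f (fun x => δ - ind D x) ((s.scale z).lev (j + 1)).1) →
        r ≤ ((coverAlgorithm n ε m K J a).step s u (w u.elem)).E f fun s =>
          chainSum f (fun x => δ - ind D x) ((s.scale z).lev j).1 -
            chainSum f (fun x => δ - ind D x) ((s.scale z).lev (j + 1)).1 := by
      intro s r hs h1 h2
      refine le_E_coverStep (X := fun I => chainSum f (fun x => δ - ind D x) (I.lev j).1 -
        chainSum f (fun x => δ - ind D x) (I.lev (j + 1)).1) (fun hz => ?_) fun hz =>
          h2 fun h => hz h.1
      have hadm : Admissible f ((2 : ℝ) ^ z) w (Function.update s.weight u.elem (w u.elem)) m K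
          (relevant f K m z us ++ [u]) := by
        rw [← relevant_concat_of_mem us hz]
        refine admissible_relevant h.m_pos h.m_le fun x hx => ?_
        by_cases hxu : x.elem = u.elem
        · rw [hxu, Function.update_self]
        · rw [Function.update_of_ne hxu]
          rcases List.mem_append.1 hx with hx | hx
          · exact hs.weight_eq x hx
          · rw [List.mem_singleton] at hx
            exact absurd (by rw [hx]) hxu
      by_cases hp : period a j ∣ (relevant f K m z us).length + 1
      · refine (h1 hz hp).trans (E_scaleStep_nonneg h.submodular (by positivity) h.m_pos h.lt_pow
          (hs.scale z) u hadm hδ hj ?_ hp)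
        rw [relevant_concat_of_mem us hz, lastRebuild_of_dvd (by simpa using hp),
          List.take_length] at hD
        exact hD
      · rw [E_scaleStep_of_not_dvd h.submodular (by positivity) h.m_pos h.lt_pow
          (hs.scale z) u hadm _ hp]
        exact h2 fun h => hp h.2
    by_cases hz : z ∈ scales K m (gain f ∅ u.elem) ∧
        period a j ∣ (relevant f K m z us).length + 1
    -- Level `j` is rebuilt now: the bound holds conditionally on every earlier state, and the
    -- induction hypothesis is not needed.
    · exact (h.ensures_comp us).le_E fun s hs =>
        hstep s 0 hs (fun _ _ => le_rfl) fun hn => absurd hz hn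
    · refine (ih ?_).trans ((h.ensures_comp us).E_mono fun s hs =>
        hstep s _ hs (fun h1 h2 => absurd ⟨h1, h2⟩ hz) fun _ => le_rfl)
      by_cases hzu : z ∈ scales K m (gain f ∅ u.elem)
      · have hp : ¬ period a j ∣ (relevant f K m z us).length + 1 := fun h => hz ⟨hzu, h⟩
        rwa [relevant_concat_of_mem us hzu, List.length_append, List.length_singleton,
          lastRebuild_succ_of_not_dvd hp,
          List.take_append_of_le_length (lastRebuild_le _ _ _)] at hD
      · rwa [relevant_concat_of_notMem us hzu] at hD

theorem E_scale_nonneg (h : Setting f w ε m K J a) {D : Finset (Fin n)} {δ : ℝ} (hδ : 0 ≤ δ)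
    (z : ℤ) (us : List (Update n))
    (hD : ∀ j < J, 4 * ((D ∩ present ((relevant f K m z us).take
      (lastRebuild a j (relevant f K m z us).length))).card : ℝ) ≤ δ * 2 ^ j) :
    0 ≤ ((coverAlgorithm n ε m K J a).comp w us).E f fun s =>
      chainSum f (fun x => δ - ind D x) ((s.scale z).lev 0).1 := by
  have h1 := Finset.sum_nonneg fun j (hj : j ∈ Finset.range J) =>
    h.E_level_nonneg hδ z (Finset.mem_range.1 hj) us (hD j (Finset.mem_range.1 hj))
  rw [← E_sum] at h1
  refine h1.trans_eq ((h.ensures_comp us).E_congr fun s hs => ?_)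
  -- The increments telescope from level `0` up to level `J`, whose solution is empty.
  rw [Finset.sum_range_sub'
    (fun j => chainSum f (fun x => δ - ind D x) ((s.scale z).lev j).1), (hs.scale z).top]
  simp [chainSum]

/-- An element present at the last rebuild and absent now was touched by one of the fewer than
`period a j` relevant updates in between. -/
theorem card_deleted_mul_le (z : ℤ) (j : ℕ) (us : List (Update n)) :
    ((present us)ᶜ ∩ present ((relevant f K m z us).take
      (lastRebuild a j (relevant f K m z us).length))).card * 2 ^ a ≤ 2 ^ j := by
  refine mul_two_pow_le_of_lt_period (lt_of_le_of_lt ?_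
    (sub_lastRebuild_lt a j (relevant f K m z us).length))
  rw [← List.length_drop]
  refine (Finset.card_le_card fun v hv => ?_).trans (card_touched_le _)
  rw [Finset.mem_inter, Finset.mem_compl] at hv
  by_contra hv'
  have := (mem_present_append_iff hv').2 hv.2
  rw [List.take_append_drop, present_relevant, Finset.mem_filter] at this
  exact hv.1 this.1

/-- Take for `D` the elements absent now and `δ = 4 / 2 ^ a`. With `x` and `y` the expected shares
of present and absent elements, `E_scale_nonneg` says `y ≤ δ * (x + y)`, while `x ≤ f V - f ∅`. -/
theorem E_loss_le (h : Setting f w ε m K J a) (z : ℤ) (us : List (Update n)) :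
    (K + 1) * (((coverAlgorithm n ε m K J a).comp w us).E f fun s =>
      chainSum f (ind (present us)ᶜ) ((s.scale z).lev 0).1) ≤
      ε * (f (present us) - f ∅) := by
  set V := present us
  have ha : (0 : ℝ) < 2 ^ a := by positivity
  have hδ : (0 : ℝ) ≤ 4 / 2 ^ a := by positivity
  have h1 := h.E_scale_nonneg (D := Vᶜ) hδ z us fun j _ => by
    have := card_deleted_mul_le (f := f) (K := K) (m := m) (a := a) z j us
    rw [div_mul_eq_mul_div, le_div_iff₀ ha, mul_assoc]
    gcongr
    exact_mod_cast this
  have h2 : ∀ l, chainSum f (fun x => 4 / 2 ^ a - ind Vᶜ x) l =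
      4 / 2 ^ a * chainSum f (ind V) l + (4 / 2 ^ a - 1) * chainSum f (ind Vᶜ) l := fun l => by
    rw [← chainSum_linear]
    congr 1
    funext x
    rw [ind_compl]; ring
  simp only [h2, E_add, E_mul] at h1
  have h3 : (((coverAlgorithm n ε m K J a).comp w us).E f fun s =>
      chainSum f (ind V) ((s.scale z).lev 0).1) ≤ f V - f ∅ := by
    rw [← E_const (f := f) ((coverAlgorithm n ε m K J a).comp w us) (f V - f ∅)]
    refine (h.ensures_comp us).E_mono fun s _ => (chainSum_ind_le h.submodular V _).trans ?_
    have := h.submodular.mono (((s.scale z).lev 0).1.toFinset ∩ V) V Finset.inter_subset_right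
    linarith
  have h4 : 0 ≤ (((coverAlgorithm n ε m K J a).comp w us).E f fun s =>
      chainSum f (ind Vᶜ) ((s.scale z).lev 0).1) :=
    (h.ensures_comp us).le_E fun s _ => chainSum_nonneg h.submodular (ind_nonneg _) _
  set x := ((coverAlgorithm n ε m K J a).comp w us).E f fun s =>
      chainSum f (ind V) ((s.scale z).lev 0).1
  set y := ((coverAlgorithm n ε m K J a).comp w us).E f fun s =>
      chainSum f (ind Vᶜ) ((s.scale z).lev 0).1
  have hF : 0 ≤ f V - f ∅ := sub_nonneg.2 (h.submodular.mono _ _ (Finset.empty_subset _))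
  have h5 : (2 ^ a - 4) * y ≤ 4 * x := by
    have e : 4 / 2 ^ a * x + (4 / 2 ^ a - 1) * y = (4 * x - (2 ^ a - 4) * y) / 2 ^ a := by
      field_simp; ring
    rw [e] at h1
    have := (div_nonneg_iff.1 h1).resolve_right fun h => by linarith [h.2]
    linarith [this.1]
  have h6 := h.le_pow
  have hK : (0 : ℝ) ≤ K := Nat.cast_nonneg K
  have h7 : (8 : ℝ) ≤ 2 ^ a := by nlinarith [h.ε_le]
  -- From `2 ^ a ≥ 8` follows `2 ^ a - 4 ≥ 2 ^ a / 2`.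
  have h8 : 2 ^ a * y ≤ 8 * (f V - f ∅) := by nlinarith
  refine le_of_mul_le_mul_left ?_ ha
  calc (2 : ℝ) ^ a * ((K + 1) * y) = (K + 1) * (2 ^ a * y) := by ring
    _ ≤ (K + 1) * (8 * (f V - f ∅)) := by gcongr
    _ = (8 * (K + 1)) * (f V - f ∅) := by ring
    _ ≤ (ε * 2 ^ a) * (f V - f ∅) := by gcongr
    _ = _ := by ring

/-- One `ε` is lost in the value test, the other through deletions, summed over at most `K + 1`
scales. -/
theorem le_E_value (h : Setting f w ε m K J a) (us : List (Update n)) :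
    (1 - 2 * ε) * f (present us) ≤
      ((coverAlgorithm n ε m K J a).comp w us).E f fun s => f s.out := by
  have h1 := (h.ensures_comp us).E_mono fun s hs => hs.le_value
  rw [E_sub, E_const, E_sum] at h1
  have hF : 0 ≤ f (present us) - f ∅ :=
    sub_nonneg.2 (h.submodular.mono _ _ (Finset.empty_subset _))
  have h2 : ∑ z ∈ scales K m (f (present us) - f ∅),
      (((coverAlgorithm n ε m K J a).comp w us).E f fun s =>
        chainSum f (ind (present us)ᶜ) ((s.scale z).lev 0).1) ≤
      ε * (f (present us) - f ∅) := by
    refine (Finset.sum_le_card_nsmul _ _ (ε * (f (present us) - f ∅) / (K + 1))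
      fun z _ => ?_).trans ?_
    · rw [le_div_iff₀ (by positivity), mul_comm]
      exact h.E_loss_le z us
    · have hc : ((scales K m (f (present us) - f ∅)).card : ℝ) ≤ K + 1 := by
        exact_mod_cast card_scales_le K m _
      have := h.ε_pos
      rw [nsmul_eq_mul]
      calc _ ≤ ((K : ℝ) + 1) * (ε * (f (present us) - f ∅) / (K + 1)) := by gcongr
        _ = _ := by field_simp
  have h3 := mul_nonneg h.ε_pos.le (h.submodular.nonneg ∅)
  linarith

end Setting

end

/-! ### The trivial algorithm and the choice of parameters -/

/-- The algorithm that always maintains the empty set. -/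
def emptyAlgorithm (n : ℕ) : DynamicAlgorithm n where
  State := Unit
  start := ()
  step _ _ _ := .ret ()
  solution _ := ∅

theorem emptyAlgorithm_ensures {n : ℕ} (w : Fin n → ℝ) (f : Finset (Fin n) → ℝ)
    (us : List (Update n)) :
    ((emptyAlgorithm n).comp w us).Ensures f 0 fun _ => True := by
  induction us using List.reverseRecOn with
  | nil => trivial
  | append_singleton us u ih =>
    rw [DynamicAlgorithm.comp_concat]
    exact ih.bind (M := 0) fun _ _ => trivial

/-- The least exponent `k` with `x ≤ 2 ^ k`. -/
noncomputable def ceilLog (x : ℝ) : ℕ := ⌈Real.logb 2 x⌉₊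

theorem le_two_pow_ceilLog {x : ℝ} (hx : 0 < x) : x ≤ 2 ^ ceilLog x := by
  rw [← Real.rpow_natCast, ← Real.logb_le_iff_le_rpow (by norm_num) hx]
  exact Nat.le_ceil _

theorem two_pow_ceilLog_le {x : ℝ} (hx : 1 ≤ x) : (2 : ℝ) ^ ceilLog x ≤ 2 * x := by
  have h := (Nat.ceil_lt_add_one (Real.logb_nonneg (b := 2) (by norm_num) hx)).le
  rw [← Real.rpow_natCast, ← Real.le_logb_iff_rpow_le (by norm_num) (by positivity),
    Real.logb_mul (by norm_num) (by positivity), Real.logb_self_eq_one (by norm_num)]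
  rw [ceilLog]
  linarith

theorem ceilLog_le {x : ℝ} (hx : 1 ≤ x) : (ceilLog x : ℝ) ≤ 2 * Real.log x + 1 := by
  have h := (Nat.ceil_lt_add_one (Real.logb_nonneg (b := 2) (by norm_num) hx)).le
  have h2 : Real.logb 2 x ≤ 2 * Real.log x := by
    rw [Real.logb, div_le_iff₀ (Real.log_pos (by norm_num))]
    nlinarith [Real.log_nonneg hx, Real.log_two_gt_d9]
  rw [ceilLog]
  linarith

theorem natLog_add_one_le {n : ℕ} (hn : 1 ≤ n) :
    ((Nat.log 2 n + 1 : ℕ) : ℝ) ≤ 2 * Real.log n + 1 := by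
  have h1 : ((2 ^ Nat.log 2 n : ℕ) : ℝ) ≤ n := by
    exact_mod_cast Nat.pow_log_le_self 2 (by omega)
  have h2 := Real.log_le_log (by positivity) h1
  push_cast at h2 ⊢
  rw [Real.log_pow] at h2
  have h3 : (0 : ℝ) ≤ Nat.log 2 n := Nat.cast_nonneg _
  nlinarith [Real.log_two_gt_d9]

/-- Here `s` stands for `1 + log n + log ρ + 1 / ε` and `A` for `2 ^ a`. The degree is `1` for `K +
1`, `1` for `J`, `4` for `levelCost` and `2` for `A`. -/
theorem levelCost_total_le {K J A : ℕ} {s : ℝ} (hs : 1 ≤ s) (hK : (K : ℝ) ≤ 2 * s)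
    (hJ : (J : ℝ) ≤ 2 * s) (hA : (A : ℝ) ≤ 48 * s ^ 2) :
    ((K + 4 + (K + 1) * (J * (levelCost K J * A)) : ℕ) : ℝ) ≤ 10 ^ 6 * s ^ 8 := by
  have h1 : ((2 * ((K + 1) * (2 * K + 4)) + 1 : ℕ) : ℝ) ≤ 49 * s ^ 2 := by
    push_cast
    have : ((K : ℝ) + 1) * (2 * K + 4) ≤ (3 * s) * (8 * s) := by gcongr <;> linarith
    nlinarith
  have h2 : ((bucketRounds K * (J + 3) + 1 : ℕ) : ℝ) ≤ 246 * s ^ 3 := by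
    rw [bucketRounds]
    have : ((2 * ((K + 1) * (2 * K + 4)) + 1 : ℕ) : ℝ) * (J + 3) ≤ 49 * s ^ 2 * (5 * s) := by
      gcongr
      linarith
    have h3 : 1 ≤ s ^ 3 := one_le_pow₀ hs
    push_cast at this ⊢
    nlinarith
  have h3 : ((levelCost K J : ℕ) : ℝ) ≤ 246 * s ^ 3 * (9 * s) := by
    rw [levelCost, Nat.cast_mul]
    gcongr
    push_cast
    linarith
  have h4 : ((K : ℝ) + 1) * (J * (levelCost K J * A)) ≤
      (3 * s) * ((2 * s) * ((246 * s ^ 3 * (9 * s)) * (48 * s ^ 2))) := by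
    gcongr
    linarith
  have h5 : s ≤ s ^ 8 := le_self_pow₀ hs (by norm_num)
  push_cast
  calc (K : ℝ) + 4 + (K + 1) * (J * (levelCost K J * A))
      ≤ 6 * s + (3 * s) * ((2 * s) * ((246 * s ^ 3 * (9 * s)) * (48 * s ^ 2))) := by linarith
    _ = 6 * s + 637632 * s ^ 8 := by ring
    _ ≤ 10 ^ 6 * s ^ 8 := by nlinarith

theorem minWeight_le {n : ℕ} (w : Fin n → ℝ) (v : Fin n) : minWeight w ≤ w v :=
  ciInf_le (Set.finite_range w).bddBelow v

theorem le_maxWeight {n : ℕ} (w : Fin n → ℝ) (v : Fin n) : w v ≤ maxWeight w :=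
  le_ciSup (Set.finite_range w).bddAbove v

theorem minWeight_pos {n : ℕ} (hn : 1 ≤ n) {w : Fin n → ℝ} (hw : ∀ v, 0 < w v) :
    0 < minWeight w := by
  have : Nonempty (Fin n) := ⟨⟨0, hn⟩⟩
  obtain ⟨v, hv⟩ := exists_eq_ciInf_of_finite (f := w)
  rw [minWeight, ← hv]
  exact hw v

/-- The exponent that determines the number of buckets. -/
noncomputable def bucketExponent (n : ℕ) (ε m M : ℝ) : ℕ := ceilLog (n * (M / m) / ε)

/-- The exponent that determines the frequency of rebuilding. -/
noncomputable def rebuildExponent (n : ℕ) (ε m M : ℝ) : ℕ :=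
  ceilLog (8 * (bucketExponent n ε m M + 1) / ε)

section

variable {n : ℕ} {w : Fin n → ℝ} {ε : ℝ}

theorem one_le_weightRatio (hn : 1 ≤ n) (hw : ∀ v, 0 < w v) : 1 ≤ weightRatio w := by
  rw [weightRatio, one_le_div (minWeight_pos hn hw)]
  exact (minWeight_le w ⟨0, hn⟩).trans (le_maxWeight w _)

theorem setting (hn : 1 ≤ n) (hw : ∀ v, 0 < w v) {f : Finset (Fin n) → ℝ}
    (hf : IsMonotoneSubmodular f) (hε : 0 < ε) (hε1 : ε ≤ 1) :
    Setting f w ε (minWeight w) (bucketExponent n ε (minWeight w) (maxWeight w))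
      (Nat.log 2 n + 1) (rebuildExponent n ε (minWeight w) (maxWeight w)) where
  submodular := hf
  m_pos := minWeight_pos hn hw
  m_le := minWeight_le w
  ε_pos := hε
  ε_le := hε1
  cost_le := by
    have hm := minWeight_pos hn hw
    have hM : 0 < maxWeight w := (hw ⟨0, hn⟩).trans_le (le_maxWeight w _)
    have hn' : (0 : ℝ) < n := by exact_mod_cast hn
    have h1 := le_two_pow_ceilLog (x := n * (maxWeight w / minWeight w) / ε) (by positivity)
    rw [bucketExponent]
    calc cost w Finset.univ ≤ n * maxWeight w := by
          simpa [cost] using Finset.sum_le_card_nsmul Finset.univ w _ fun v _ => le_maxWeight w v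
      _ = ε * minWeight w * (n * (maxWeight w / minWeight w) / ε) := by field_simp
      _ ≤ _ := by gcongr
  lt_pow := Nat.lt_pow_succ_log_self (by norm_num) n
  J_pos := Nat.succ_pos _
  le_pow := by
    have h1 := le_two_pow_ceilLog
      (x := 8 * (bucketExponent n ε (minWeight w) (maxWeight w) + 1) / ε) (by positivity)
    rw [rebuildExponent]
    rwa [div_le_iff₀ hε, mul_comm (2 ^ _)] at h1

theorem cost_parameters_le (hn : 1 ≤ n) (hw : ∀ v, 0 < w v) (hε : 0 < ε) (hε1 : ε ≤ 1) :
    ((bucketExponent n ε (minWeight w) (maxWeight w) + 4 +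
      (bucketExponent n ε (minWeight w) (maxWeight w) + 1) * ((Nat.log 2 n + 1) *
        (levelCost (bucketExponent n ε (minWeight w) (maxWeight w)) (Nat.log 2 n + 1) *
          2 ^ rebuildExponent n ε (minWeight w) (maxWeight w))) : ℕ) : ℝ) ≤
      10 ^ 6 * (1 + Real.log n + Real.log (weightRatio w) + 1 / ε) ^ 8 := by
  have hn' : (1 : ℝ) ≤ n := by exact_mod_cast hn
  have hρ := one_le_weightRatio hn hw
  have hε' : 1 ≤ 1 / ε := by rwa [one_le_div hε]
  have hx := Real.log_nonneg hn'
  have hy := Real.log_nonneg hρ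
  have hz : Real.log (1 / ε) ≤ 1 / ε := (Real.log_le_sub_one_of_pos (by positivity)).trans
    (by linarith)
  have e : n * (maxWeight w / minWeight w) / ε = n * weightRatio w * (1 / ε) := by
    rw [weightRatio]; ring
  have h1 : 1 ≤ n * weightRatio w * (1 / ε) :=
    one_le_mul_of_one_le_of_one_le (one_le_mul_of_one_le_of_one_le hn' hρ) hε'
  have hK : (bucketExponent n ε (minWeight w) (maxWeight w) : ℝ) ≤
      2 * (1 + Real.log n + Real.log (weightRatio w) + 1 / ε) := by
    rw [bucketExponent, e]
    refine (ceilLog_le h1).trans ?_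
    rw [Real.log_mul (by positivity) (by positivity), Real.log_mul (by positivity) (by positivity)]
    linarith
  refine levelCost_total_le (by linarith) hK ((natLog_add_one_le hn).trans (by linarith)) ?_
  have hK0 : (0 : ℝ) ≤ bucketExponent n ε (minWeight w) (maxWeight w) := Nat.cast_nonneg _
  rw [rebuildExponent]
  push_cast
  refine (two_pow_ceilLog_le ?_).trans ?_
  · rw [le_div_iff₀ hε]
    linarith
  · set s := 1 + Real.log n + Real.log (weightRatio w) + 1 / ε
    set k := (bucketExponent n ε (minWeight w) (maxWeight w) : ℝ)
    calc 2 * (8 * (k + 1) / ε) = 16 * ((k + 1) * (1 / ε)) := by ring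
      _ ≤ 16 * ((3 * s) * s) := by
        gcongr
        · linarith
        · linarith
      _ = 48 * s ^ 2 := by ring

end

/-- The algorithm depends on `ε` and is given `n` and the least and the largest weight; the
constant `C` hidden in the `O`-notation and the polynomial `P` are absolute. -/
theorem theorem1 :
    ∃ (C : ℝ) (P : MvPolynomial (Fin 3) ℝ), 0 < C ∧
      ∀ ε : ℝ, 0 < ε →
        ∃ alg : (n : ℕ) → (wmin wmax : ℝ) → DynamicAlgorithm n,
          ∀ (n : ℕ), 1 ≤ n →
          ∀ (w : Fin n → ℝ), (∀ v, 0 < w v) →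
          ∀ (f : Finset (Fin n) → ℝ), IsMonotoneSubmodular f →
          ∀ (us : List (Update n)) (A : DynamicAlgorithm n) (V : Finset (Fin n)),
            A = alg n (minWeight w) (maxWeight w) → V = present us →
            -- the maintained solution consists of present elements and has small cost
            (∀ x ∈ (A.exec w f us).support,
              A.solution x.1 ⊆ V ∧
              cost w (A.solution x.1) ≤ C / ε * optCost w f V) ∧
            -- its expected value is large
            ENNReal.ofReal ((1 - C * ε) * f V) ≤
              expect (A.exec w f us) (fun x => ENNReal.ofReal (f (A.solution x.1))) ∧
            -- the expected total number of queries, amortized over the updates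
            expect (A.exec w f us) (fun x => (x.2 : ENNReal)) ≤
              ENNReal.ofReal ((us.length : ℝ) *
                MvPolynomial.eval ![Real.log n, Real.log (weightRatio w), 1 / ε] P) := by
  refine ⟨2, MvPolynomial.C (10 ^ 6) * (1 + MvPolynomial.X 0 + MvPolynomial.X 1 +
    MvPolynomial.X 2) ^ 8, two_pos, fun ε hε => ?_⟩
  rcases le_or_gt ε 1 with hε1 | hε1
  · refine ⟨fun n m M => coverAlgorithm n ε m (bucketExponent n ε m M) (Nat.log 2 n + 1)
      (rebuildExponent n ε m M), ?_⟩
    rintro n hn w hw f hf us A V rfl rfl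
    have h := setting hn hw hf hε hε1
    have hens := h.ensures_comp us
    rw [DynamicAlgorithm.exec_eq_run_comp]
    refine ⟨fun x hx => ?_, ?_, ?_⟩
    · have := (hens.of_mem_support hx).1
      exact ⟨this.out_subset, this.cost_le⟩
    · rw [OracleComp.expect_run _ _ fun s => hf.nonneg _]
      exact ENNReal.ofReal_le_ofReal (h.le_E_value us)
    · refine expect_le_of_forall_mem_support _ _ _ fun x hx => ?_
      rw [← ENNReal.ofReal_natCast]
      refine ENNReal.ofReal_le_ofReal ?_
      have h1 := ((hens.of_mem_support hx).2).trans (queryBound_le _ us)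
      have h2 := mul_le_mul_of_nonneg_left (cost_parameters_le hn hw hε hε1)
        (Nat.cast_nonneg (α := ℝ) us.length)
      refine (Nat.cast_le.2 h1).trans ?_
      rw [Nat.cast_mul]
      refine h2.trans_eq ?_
      simp
  -- For `ε > 1` the factor `1 - 2 * ε` is negative, so the empty solution without any query is good
  -- enough.
  · refine ⟨fun n _ _ => emptyAlgorithm n, ?_⟩
    rintro n hn w hw f hf us A V rfl rfl
    have hens := emptyAlgorithm_ensures w f us
    rw [DynamicAlgorithm.exec_eq_run_comp]
    refine ⟨fun x _ => ⟨Finset.empty_subset _, ?_⟩, ?_, ?_⟩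
    · obtain ⟨S, -, -, h⟩ := exists_optCost_eq w f (present us)
      rw [h]
      have := cost_nonneg hw S
      simp only [emptyAlgorithm, cost, Finset.sum_empty] at this ⊢
      positivity
    · rw [ENNReal.ofReal_of_nonpos]
      · exact zero_le
      · exact mul_nonpos_of_nonpos_of_nonneg (by linarith) (hf.nonneg _)
    · refine expect_le_of_forall_mem_support _ _ _ fun x hx => ?_
      rw [Nat.le_zero.1 (hens.of_mem_support hx).2]
      simp
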